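/- Let $n\ge 2$, let $M$ be a nonempty compact smooth $n$-manifold (without boundary), $k\ge 1$ an integer, and $a,b,c\in\mathbb R$ with $c>0$. For Riemannian metrics $g,h$ on $M$, let $\mathrm{Ric}$, $S$, $\nabla$, $\Delta=\operatorname{tr}^g\nabla^2$ be the Ricci curvature, scalar curvature, Levi-Civita connection and rough Laplacian of $g$, and put $$T^g_{k,a,b,c}=(-1)^{k+1}c\bigl(\Delta^k\mathrm{Ric}+a\,(\Delta^kS)\,g-b\,\Delta^{k-1}\nabla^2S\bigr)+T_{2k+1}^g ,$$ where $T_{2k+1}$ is any polynomial natural symmetric covariant 2-tensor of order at most $2k+1$ (it commutes with pullback by diffeomorphisms, and in all coordinate systems its components are fixed polynomials in the coordinate derivatives of $g_{ij}$ of order $\le 2k+1$ and in the entries of $g^{-1}$). Let $\nabla^{g,h}$ be the mixed covariant derivative (the connection of $g$ acts on lower indices, that of $h$ on upper indices), $\Delta^{g,h}=\operatorname{tr}^g\nabla^{g,h}\nabla^{g,h}$, let $A=\Gamma^g-\Gamma^h$ be the difference of the Christoffel symbols, $V^\gamma=g^{ij}A_{ij}^\gamma$, $Z^\gamma=g^{\mu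 i}g^{\nu j}\nabla^{g,h}_\mu\nabla^{g,h}_\nu A_{ij}^\gamma$, and for $\alpha,\beta\in\mathbb R$ put $$W^{g,h}_{c,\alpha,\beta}=(-1)^kc\bigl[\alpha(\Delta^{g,h})^kV+\beta(\Delta^{g,h})^{k-1}Z\bigr],\qquad L^{g,h}_{k,a,b,c,\alpha,\beta}=T^g_{k,a,b,c}+\mathcal L_{W^{g,h}_{c,\alpha,\beta}}g .$$ A linear differential operator $P=\sum_{|\kappa|\le 2m}a_\kappa D^\kappa$ ($\kappa$ a multi-index) of order $2m$ on symmetric covariant 2-tensors, possibly depending on a parameter $t$, has principal symbol $\sigma_\xi(P)=(-1)^m\sum_{|\kappa|=2m}a_\kappa\,\xi^\kappa$. It is strongly elliptic, with respect to metrics $g(t)$, if there is a constant $\Lambda>0$, independent of $t$, such that $\langle\sigma_\xi(P)\eta,\eta\rangle\ge\Lambda|\xi|^{2m}|\eta|^2$ for all $t$, all points $x\in M$, all $\xi\in T_x^*M$ and all symmetric covariant 2-tensors $\eta$ at $x$, where the inner product and norms are those of $g(t)$. Let $h$ be a Riemannian metric on $M$ and $g(t)$, $t\in I$, a family of Riemannian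 metrics on $M$, where $I\subseteq\mathbb R$ is nonempty (for instance a single metric $g$, possibly $g=h$). For all $\alpha,\beta$, the linearization of $g\mapsto -L^{g,h}_{k,a,b,c,\alpha,\beta}$ at $g(t)$ is a linear differential operator of order $2k+2$ with smooth coefficients on symmetric covariant 2-tensors. Moreover: 1. If $a>-\frac1{2(n-1)}$, then for $\alpha=\frac12+a-b$ and $\beta=b-a$ this family of linearizations is strongly elliptic. 2. If $a\le-\frac1{2(n-1)}$, then for no choice of $\alpha,\beta\in\mathbb R$ is it strongly elliptic. -/

import Mathlib

open scoped Manifold ContDiff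

noncomputable section

namespace TensorFlow

/-! ### Calculus in a coordinate chart -/

/-- The model space `ℝⁿ`. -/
abbrev Model (n : ℕ) : Type := EuclideanSpace ℝ (Fin n)

/-- The coordinate derivative `∂_i f`. -/
def pd {n : ℕ} (i : Fin n) (f : Model n → ℝ) : Model n → ℝ :=
  fun y => fderiv ℝ f y (EuclideanSpace.single i 1)

/-- `D^β f = ∂_1^{β_1} ⋯ ∂_n^{β_n} f` for a multi-index `β`. -/
def multiPd {n : ℕ} (β : Fin n → ℕ) (f : Model n → ℝ) : Model n → ℝ :=
  (List.finRange n).foldr (fun i F => (pd i)^[β i] F) f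

/-- Coordinate expression of a `(0,2)`-tensor field (two lower indices). -/
abbrev MatrixField (n : ℕ) : Type := Model n → Matrix (Fin n) (Fin n) ℝ

/-- `u` is smooth and symmetric on `U`. -/
def IsSmoothSymm {n : ℕ} (U : Set (Model n)) (u : MatrixField n) : Prop :=
  (∀ i j, ContDiffOn ℝ ∞ (fun y => u y i j) U) ∧ ∀ y ∈ U, (u y).IsSymm

/-- `g` is (the coordinate expression of) a smooth Riemannian metric on `U`. -/
def IsLocalMetric {n : ℕ} (U : Set (Model n)) (g : MatrixField n) : Prop :=
  IsSmoothSymm U g ∧ ∀ y ∈ U, (g y).PosDef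

/-- Coordinate expression of a tensor field with `p` lower and `q` upper indices:
`F I J y = F^{J_1 ⋯ J_q}_{I_1 ⋯ I_p}(y)`. -/
abbrev TensorField (n p q : ℕ) : Type := (Fin p → Fin n) → (Fin q → Fin n) → Model n → ℝ

/-- A `(0,2)`-tensor field as a tensor field with two lower indices. -/
def MatrixField.toTensor {n : ℕ} (u : MatrixField n) : TensorField n 2 0 :=
  fun I _ y => u y (I 0) (I 1)

/-- A scalar function as a tensor field without indices. -/
def scalarTensor {n : ℕ} (f : Model n → ℝ) : TensorField n 0 0 := fun _ _ => f

/-- Christoffel symbols of `g`: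
`Γ^k_{ij} = ½ g^{kl} (∂_i g_{jl} + ∂_j g_{il} - ∂_l g_{ij})`, written `christoffel g k i j`. -/
def christoffel {n : ℕ} (g : MatrixField n) (k i j : Fin n) : Model n → ℝ := fun y =>
  (1 / 2) * ∑ l, (g y)⁻¹ k l *
    (pd i (fun z => g z j l) y + pd j (fun z => g z i l) y - pd l (fun z => g z i j) y)

/-- The Ricci curvature of `g`:
`R_{ij} = ∂_k Γ^k_{ij} - ∂_j Γ^k_{ik} + Γ^k_{kl} Γ^l_{ij} - Γ^k_{jl} Γ^l_{ik}`. -/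
def ricci {n : ℕ} (g : MatrixField n) : MatrixField n := fun y =>
  Matrix.of fun i j =>
    ∑ k, (pd k (christoffel g k i j) y - pd j (christoffel g k i k) y) +
    ∑ k, ∑ l, (christoffel g k k l y * christoffel g l i j y -
      christoffel g k j l y * christoffel g l i k y)

/-- The scalar curvature `S = g^{ij} R_{ij}`. -/
def scalarCurv {n : ℕ} (g : MatrixField n) : Model n → ℝ := fun y =>
  ∑ i, ∑ j, (g y)⁻¹ i j * ricci g y i j

/-- The mixed covariant derivative `∇^{g,h} F`: the Levi-Civita connection of `g` acts on lower
indices and that of `h` on upper indices. The new (derivative) index is the last lower one.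
For `h = g` this is the Levi-Civita covariant derivative `∇^g`. -/
def mixedCov {n p q : ℕ} (g h : MatrixField n) (F : TensorField n p q) :
    TensorField n (p + 1) q := fun I J y =>
  let I' : Fin p → Fin n := fun l => I l.castSucc
  let m : Fin n := I (Fin.last p)
  pd m (F I' J) y
    - ∑ l, ∑ c, F (Function.update I' l c) J y * christoffel g c m (I' l) y
    + ∑ l, ∑ c, F I' (Function.update J l c) y * christoffel h (J l) c m y

/-- The mixed Laplacian `Δ^{g,h} F = g^{μν} ∇^{g,h}_μ ∇^{g,h}_ν F`.
For `h = g` this is the (rough) Laplacian of `g`. -/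
def mixedLap {n p q : ℕ} (g h : MatrixField n) (F : TensorField n p q) : TensorField n p q :=
  fun I J y => ∑ μ, ∑ ν, (g y)⁻¹ μ ν *
    mixedCov g h (mixedCov g h F)
      (Fin.snoc (α := fun _ => Fin n) (Fin.snoc (α := fun _ => Fin n) I ν) μ) J y

/-- The difference tensor `A^{g,h} = Γ^g - Γ^h`. -/
def diffTensor {n : ℕ} (g h : MatrixField n) : TensorField n 2 1 := fun I J y =>
  christoffel g (J 0) (I 0) (I 1) y - christoffel h (J 0) (I 0) (I 1) y

/-- The vector field `V^γ = g^{αβ} A^γ_{αβ}`. -/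
def vecV {n : ℕ} (g h : MatrixField n) : TensorField n 0 1 := fun _ J y =>
  ∑ α, ∑ β, (g y)⁻¹ α β * diffTensor g h ![α, β] J y

/-- The vector field `Z^γ = g^{μα} g^{νβ} ∇^{g,h}_μ ∇^{g,h}_ν A^γ_{αβ}`. -/
def vecZ {n : ℕ} (g h : MatrixField n) : TensorField n 0 1 := fun _ J y =>
  ∑ μ, ∑ ν, ∑ α, ∑ β, (g y)⁻¹ μ α * (g y)⁻¹ ν β *
    mixedCov g h (mixedCov g h (diffTensor g h)) ![α, β, ν, μ] J y

/-- The Lie derivative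
`(ℒ_W g)_{ij} = W^k ∂_k g_{ij} + g_{kj} ∂_i W^k + g_{ik} ∂_j W^k`. -/
def lieMetric {n : ℕ} (W : TensorField n 0 1) (g : MatrixField n) : MatrixField n := fun y =>
  Matrix.of fun i j => ∑ k, (W ![] ![k] y * pd k (fun z => g z i j) y
    + g y k j * pd i (W ![] ![k]) y + g y i k * pd j (W ![] ![k]) y)

/-! ### Polynomial natural symmetric tensors of a single metric -/

/-- The variables of a coordinate expression of order `r` in a metric `g`: the derivatives
`D^β g_{ij}` with `|β| ≤ r`, and the entries of `g⁻¹`. -/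
abbrev JetVar (n r : ℕ) : Type :=
  ({β : Fin n → ℕ // ∑ i, β i ≤ r} × Fin n × Fin n) ⊕ (Fin n × Fin n)

/-- The values of these variables for the metric `g` at `y`. -/
def jetVal {n r : ℕ} (g : MatrixField n) (y : Model n) : JetVar n r → ℝ
  | Sum.inl (β, i, j) => multiPd β.1 (fun z => g z i j) y
  | Sum.inr (i, j) => (g y)⁻¹ i j

/-- The `(0,2)`-tensor field with polynomial components `Q`, for the metric `g`. -/
def polyTensor {n r : ℕ} (Q : Fin n → Fin n → MvPolynomial (JetVar n r) ℝ) (g : MatrixField n) :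
    MatrixField n :=
  fun y => Matrix.of fun i j => MvPolynomial.eval (jetVal g y) (Q i j)

/-- The Jacobian matrix `∂φ^i / ∂y^j`. -/
def jacobian {n : ℕ} (φ : Model n → Model n) : MatrixField n :=
  fun y => Matrix.of fun i j => pd j (fun z => φ z i) y

/-- The pullback `φ^* u` of a `(0,2)`-tensor field. -/
def pullback {n : ℕ} (φ : Model n → Model n) (u : MatrixField n) : MatrixField n :=
  fun y => (jacobian φ y).transpose * u (φ y) * jacobian φ y

/-- A polynomial natural symmetric `(0,2)`-tensor of order `r` for a single metric in dimension `n`: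
in every coordinate system its components are given by the same polynomials in the `D^β g_{ij}`,
`|β| ≤ r`, and the entries of `g⁻¹`, and it commutes with pullback by diffeomorphisms. -/
structure PolyNaturalTensor (n r : ℕ) where
  /-- The component polynomials. -/
  poly : Fin n → Fin n → MvPolynomial (JetVar n r) ℝ
  symm : ∀ (U : Set (Model n)) (g : MatrixField n), IsOpen U → IsLocalMetric U g →
    ∀ y ∈ U, (polyTensor poly g y).IsSymm
  natural : ∀ (φ : OpenPartialHomeomorph (Model n) (Model n)) (g : MatrixField n),
    ContDiffOn ℝ ∞ φ φ.source → ContDiffOn ℝ ∞ φ.symm φ.target → IsLocalMetric φ.target g →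
    ∀ y ∈ φ.source, polyTensor poly (pullback φ g) y = pullback φ (polyTensor poly g) y

/-! ### The adjusted flow operator -/

/-- `T^g_{k,a,b,c} = (-1)^{k+1} c (Δ^k Ric + a (Δ^k S) g - b Δ^{k-1} ∇²S) + T_{2k+1}`, in
coordinates. -/
def flowTensor {n : ℕ} (k : ℕ) (a b c : ℝ) (T₀ : PolyNaturalTensor n (2 * k + 1))
    (g : MatrixField n) : MatrixField n := fun y => Matrix.of fun i j =>
  (-1) ^ (k + 1) * c *
    ((mixedLap g g)^[k] (ricci g).toTensor ![i, j] ![] y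
      + a * ((mixedLap g g)^[k] (scalarTensor (scalarCurv g)) ![] ![] y * g y i j)
      - b * (mixedLap g g)^[k - 1]
          (mixedCov g g (mixedCov g g (scalarTensor (scalarCurv g)))) ![i, j] ![] y)
    + polyTensor T₀.poly g y i j

/-- `W^{g,h}_{c,α,β} = (-1)^k c (α (Δ^{g,h})^k V^{g,h} + β (Δ^{g,h})^{k-1} Z^{g,h})`. -/
def adjustField {n : ℕ} (k : ℕ) (c α β : ℝ) (g h : MatrixField n) : TensorField n 0 1 :=
  fun I J y => (-1) ^ k * c *
    (α * (mixedLap g h)^[k] (vecV g h) I J y + β * (mixedLap g h)^[k - 1] (vecZ g h) I J y)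

/-- `L^{g,h}_{k,a,b,c,α,β} = T^g_{k,a,b,c} + ℒ_W g` with `W = W^{g,h}_{c,α,β}`. -/
def adjustedOp {n : ℕ} (k : ℕ) (a b c α β : ℝ) (T₀ : PolyNaturalTensor n (2 * k + 1))
    (g h : MatrixField n) : MatrixField n :=
  fun y => flowTensor k a b c T₀ g y + lieMetric (adjustField k c α β g h) g y

/-- The linearization of `F` at `g`: `u ↦ d/ds|_{s=0} F(g + s u)`. -/
def linearization {n : ℕ} (F : MatrixField n → MatrixField n) (g : MatrixField n) :
    MatrixField n → MatrixField n :=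
  fun u y => Matrix.of fun i j => deriv (fun s : ℝ => F (g + s • u) y i j) 0

/-! ### Linear differential operators and strong ellipticity -/

/-- Coefficients `a_β(y)` of a linear differential operator on `(0,2)`-tensor fields. -/
abbrev OpCoeff (n : ℕ) : Type :=
  (Fin n → ℕ) → Model n → Matrix (Fin n) (Fin n) ℝ →ₗ[ℝ] Matrix (Fin n) (Fin n) ℝ

/-- On symmetric `(0,2)`-tensor fields over `U`, the operator `P` is the linear differential operator
`∑_{|β| ≤ r} a_β D^β` of order `r` with smooth coefficients `a_β`, and it takes symmetric values. -/
def IsDiffOpWith {n : ℕ} (U : Set (Model n)) (r : ℕ) (a : OpCoeff n)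
    (P : MatrixField n → MatrixField n) : Prop :=
  (∀ β η i j, ContDiffOn ℝ ∞ (fun y => a β y η i j) U) ∧
  ∀ u, IsSmoothSymm U u → ∀ y ∈ U, (P u y).IsSymm ∧
    P u y = ∑ d ∈ Finset.range (r + 1), ∑ β ∈ Finset.piAntidiag (Finset.univ : Finset (Fin n)) d,
      a β y (Matrix.of fun i j => multiPd β (fun z => u z i j) y)

/-- The principal symbol `σ_ξ = (-1)^m ∑_{|β| = 2m} a_β(y) ξ^β` of an operator of order `2m`. -/
def principalSymbol {n : ℕ} (m : ℕ) (a : OpCoeff n) (y : Model n) (ξ : Fin n → ℝ)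
    (η : Matrix (Fin n) (Fin n) ℝ) : Matrix (Fin n) (Fin n) ℝ :=
  (-1 : ℝ) ^ m • ∑ β ∈ Finset.piAntidiag (Finset.univ : Finset (Fin n)) (2 * m),
    (∏ i, ξ i ^ β i) • a β y η

/-- `|ξ|² = g^{ij} ξ_i ξ_j` for the inner product `G = (g_{ij})`. -/
def covectorNormSq {n : ℕ} (G : Matrix (Fin n) (Fin n) ℝ) (ξ : Fin n → ℝ) : ℝ :=
  ∑ i, ∑ j, G⁻¹ i j * ξ i * ξ j

/-- `⟨θ, η⟩ = g^{ik} g^{jl} θ_{ij} η_{kl}` for the inner product `G = (g_{ij})`. -/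
def tensorInner {n : ℕ} (G θ η : Matrix (Fin n) (Fin n) ℝ) : ℝ :=
  ∑ i, ∑ j, ∑ k, ∑ l, G⁻¹ i k * G⁻¹ j l * θ i j * η k l

section Mfd

variable (n : ℕ) (M : Type*) [TopologicalSpace M] [ChartedSpace (Model n) M]
  [IsManifold 𝓘(ℝ, Model n) ∞ M]

/-- Smooth Riemannian metrics on `M`. -/
abbrev Metric : Type _ :=
  Bundle.ContMDiffRiemannianMetric 𝓘(ℝ, Model n) ∞ (Model n)
    (fun x : M => TangentSpace 𝓘(ℝ, Model n) x)

/-- The smooth charts of `M`. -/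
abbrev charts : Set (OpenPartialHomeomorph M (Model n)) :=
  IsManifold.maximalAtlas 𝓘(ℝ, Model n) ∞ M

variable {n M}

/-- The coordinate expression `g_{ij}` of a metric on `M` in a chart `e`. -/
def Metric.inChart (g : Metric n M) (e : OpenPartialHomeomorph M (Model n)) : MatrixField n :=
  fun y => Matrix.of fun i j =>
    g.inner (e.symm y)
      (mfderiv 𝓘(ℝ, Model n) 𝓘(ℝ, Model n) e.symm y (EuclideanSpace.single i (1 : ℝ) : Model n))
      (mfderiv 𝓘(ℝ, Model n) 𝓘(ℝ, Model n) e.symm y (EuclideanSpace.single j (1 : ℝ) : Model n))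

/-- `P t` for `t ∈ I`, given by its coordinate expressions `P t e` in the smooth charts `e` of `M`,
is a family of linear differential operators of order `r` on symmetric `(0,2)`-tensor fields. -/
def IsLinearDiffOp (I : Set ℝ) (r : ℕ)
    (P : ℝ → OpenPartialHomeomorph M (Model n) → MatrixField n → MatrixField n) : Prop :=
  ∀ t ∈ I, ∀ e ∈ charts n M, ∃ a : OpCoeff n, IsDiffOpWith e.target r a (P t e)

/-- Strong ellipticity of a family `P t`, `t ∈ I`, of linear differential operators of order `2m`,
where inner products and norms at time `t` are those of the metric `g t`: there is a constant
`Λ > 0`, independent of `t`, with `⟨σ_ξ(P t) η, η⟩ ≥ Λ |ξ|^{2m} |η|²` at all points, for all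
covectors `ξ` and all symmetric `η`. -/
def StronglyElliptic (I : Set ℝ) (m : ℕ) (g : ℝ → Metric n M)
    (P : ℝ → OpenPartialHomeomorph M (Model n) → MatrixField n → MatrixField n) : Prop :=
  ∃ Λ : ℝ, 0 < Λ ∧ ∀ t ∈ I, ∀ e ∈ charts n M, ∃ a : OpCoeff n,
    IsDiffOpWith e.target (2 * m) a (P t e) ∧
    ∀ y ∈ e.target, ∀ (ξ : Fin n → ℝ) (η : Matrix (Fin n) (Fin n) ℝ), η.IsSymm →
      Λ * covectorNormSq ((g t).inChart e y) ξ ^ m * tensorInner ((g t).inChart e y) η η ≤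
        tensorInner ((g t).inChart e y) (principalSymbol m a y ξ η) η

/-- The linearization of `-L^{·,h}_{k,a,b,c,α,β}` at the metric `g`, in the chart `e`. -/
def negLinOp (k : ℕ) (a b c α β : ℝ) (T₀ : PolyNaturalTensor n (2 * k + 1))
    (g h : Metric n M) (e : OpenPartialHomeomorph M (Model n)) :
    MatrixField n → MatrixField n :=
  linearization (fun g' y => -adjustedOp k a b c α β T₀ g' (h.inChart e) y) (g.inChart e)

end Mfd

end TensorFlow

end

noncomputable section

namespace TensorFlow

/-! ### Coordinate derivatives, multi-indices and test functions. -/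

section Calculus

variable {n : ℕ} {U : Set (Model n)}

/-! The proof computes the principal symbol of the linearization in a chart and reduces both claims
to linear algebra at one point.

Fix a metric `g` with inverse `G`, a covector `ξ` and a symmetric `η`. Put `q = |ξ|²`, `v = Gξ`, `t
= tr(Gη)`, `e = η(v,v)`, and let `s = e - q t` be the symbol of the linearized scalar curvature. The
Ricci symbol is `½(ξ_i (ηv)_j + ξ_j (ηv)_i - q η_ij - t ξ_i ξ_j)`. Each Laplacian multiplies a
symbol by `q`, and the Lie derivative adds terms `ξ_i W_j + ξ_j W_i`. Pairing the symbol of `-L`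
with `η` gives (`tensorInner_adjustedOpSymbol`) `c q^(k-1) [½ q²|η|² - a q s t - (1 - 2(α+β)) q
|ηv|² - ((α - ½) q t + β e - b s) e]`.

As in DeTurck's trick, `α + β = ½` removes the `|ηv|²` term. With `α = ½ + a - b` and `β = b - a`
the last bracket becomes `-a s`, and since `e = s + q t` the whole expression collapses to `c
q^(k-1) (½ q²|η|² + a s²)`. Moreover `s = -⟨θ, η⟩` for `θ = q g - ξ⊗ξ`, and `|θ|² = (n-1) q²`, so
Cauchy–Schwarz gives `s² ≤ (n-1) q² |η|²`. This yields the constant `c(½ + min(a,0)(n-1))`, which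
depends on neither the point nor `t`, and is positive when `a > -1/(2(n-1))`.

For the converse take `η = θ`. Since `θv = 0`, the tensor `θ` is orthogonal to every `ξ_i w_j + ξ_j
w_i`, so neither `α` nor `β` has any influence. The form takes the value `c q^(k+3) (n-1)(½ +
a(n-1))`, which is not positive when `a ≤ -1/(2(n-1))`.

The analytic part is a calculus of symbols, `HasSymbol`: functionals of a metric whose linearization
is a differential operator with a known top symbol are closed under sums, products, coordinate
derivatives and the entries of `g⁻¹`, and anything of lower order has zero top symbol. Two further
points are needed. The linearization must take symmetric values, which rests on the symmetry of
Ricci and of the Hessian and on `g + s u` remaining a metric near a point for small `s`. And the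
symbol on symmetric `η` must depend on the operator alone, not on the chosen coefficients, so that
the converse excludes every choice; this is `IsDiffOpWith.principalSymbol_eq`. -/

theorem contDiffOn_pd (hU : IsOpen U) {f : Model n → ℝ} (hf : ContDiffOn ℝ ∞ f U) (i : Fin n) :
    ContDiffOn ℝ ∞ (pd i f) U :=
  (hf.fderiv_of_isOpen hU le_rfl).clm_apply contDiffOn_const

theorem differentiableAt_of_contDiffOn (hU : IsOpen U) {f : Model n → ℝ}
    (hf : ContDiffOn ℝ ∞ f U) {y : Model n} (hy : y ∈ U) : DifferentiableAt ℝ f y :=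
  (hf.contDiffAt (hU.mem_nhds hy)).differentiableAt (by simp)

theorem pd_congr_nhds {f f' : Model n → ℝ} {y : Model n} (h : f =ᶠ[nhds y] f') (i : Fin n) :
    pd i f y = pd i f' y := by
  unfold pd; rw [h.fderiv_eq]

theorem pd_congr (hU : IsOpen U) {f f' : Model n → ℝ} (h : Set.EqOn f f' U) (i : Fin n) :
    Set.EqOn (pd i f) (pd i f') U := fun _ hy =>
  pd_congr_nhds (h.eventuallyEq_of_mem (hU.mem_nhds hy)) i

theorem pd_iterate_congr (hU : IsOpen U) {f f' : Model n → ℝ} (h : Set.EqOn f f' U) (i : Fin n)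
    (m : ℕ) : Set.EqOn ((pd i)^[m] f) ((pd i)^[m] f') U := by
  induction m with
  | zero => exact h
  | succ m ih =>
    rw [Function.iterate_succ_apply', Function.iterate_succ_apply']
    exact pd_congr hU ih i

theorem contDiffOn_pd_iterate (hU : IsOpen U) {f : Model n → ℝ} (hf : ContDiffOn ℝ ∞ f U)
    (i : Fin n) (m : ℕ) : ContDiffOn ℝ ∞ ((pd i)^[m] f) U := by
  induction m with
  | zero => exact hf
  | succ m ih => rw [Function.iterate_succ_apply']; exact contDiffOn_pd hU ih i

theorem pd_const (i : Fin n) (c : ℝ) : pd i (fun _ => c) = fun _ => 0 := by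
  funext y; simp [pd]

theorem pd_mul {f f' : Model n → ℝ} {y : Model n} (hf : DifferentiableAt ℝ f y)
    (hf' : DifferentiableAt ℝ f' y) (i : Fin n) :
    pd i (fun z => f z * f' z) y = pd i f y * f' y + f y * pd i f' y := by
  simp [pd, fderiv_fun_mul hf hf']; ring

theorem pd_const_mul {f : Model n → ℝ} {y : Model n} (hf : DifferentiableAt ℝ f y)
    (c : ℝ) (i : Fin n) : pd i (fun z => c * f z) y = c * pd i f y := by
  simp [pd, fderiv_const_mul hf c]

theorem pd_sum {ι : Type*} (s : Finset ι) {f : ι → Model n → ℝ} {y : Model n}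
    (hf : ∀ a ∈ s, DifferentiableAt ℝ (f a) y) (i : Fin n) :
    pd i (fun z => ∑ a ∈ s, f a z) y = ∑ a ∈ s, pd i (f a) y := by
  simp [pd, fderiv_fun_sum hf]

theorem pd_comm (hU : IsOpen U) {f : Model n → ℝ} (hf : ContDiffOn ℝ ∞ f U) (i j : Fin n) :
    Set.EqOn (pd i (pd j f)) (pd j (pd i f)) U := by
  intro y hy
  have hfy := hf.contDiffAt (hU.mem_nhds hy)
  have hd : DifferentiableAt ℝ (fderiv ℝ f) y :=
    (hfy.fderiv_right (m := ∞) le_rfl).differentiableAt (by simp)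
  have hs : IsSymmSndFDerivAt ℝ f y := hfy.isSymmSndFDerivAt (by
    rw [minSmoothness_of_isRCLikeNormedField]; exact ENat.LEInfty.out)
  have key : ∀ a b : Fin n, pd a (pd b f) y =
      fderiv ℝ (fderiv ℝ f) y (EuclideanSpace.single a 1) (EuclideanSpace.single b 1) := by
    intro a b
    unfold pd
    rw [fderiv_clm_apply hd (differentiableAt_const _)]
    simp
  rw [key, key]
  exact hs _ _

theorem pd_pd_iterate_comm (hU : IsOpen U) {f : Model n → ℝ} (hf : ContDiffOn ℝ ∞ f U)
    (i j : Fin n) (m : ℕ) : Set.EqOn (pd i ((pd j)^[m] f)) ((pd j)^[m] (pd i f)) U := by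
  induction m with
  | zero => exact fun _ _ => rfl
  | succ m ih =>
    rw [Function.iterate_succ_apply', Function.iterate_succ_apply']
    exact (pd_comm hU (contDiffOn_pd_iterate hU hf j m) i j).trans (pd_congr hU ih j)

/-- Iterated coordinate derivatives along the directions in a list. -/
def listPd (l : List (Fin n)) (β : Fin n → ℕ) (f : Model n → ℝ) : Model n → ℝ :=
  l.foldr (fun i F => (pd i)^[β i] F) f

theorem listPd_cons (j : Fin n) (l : List (Fin n)) (β : Fin n → ℕ) (f : Model n → ℝ) :
    listPd (j :: l) β f = (pd j)^[β j] (listPd l β f) := rfl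

theorem contDiffOn_listPd (hU : IsOpen U) {f : Model n → ℝ} (hf : ContDiffOn ℝ ∞ f U)
    (β : Fin n → ℕ) (l : List (Fin n)) : ContDiffOn ℝ ∞ (listPd l β f) U := by
  induction l with
  | nil => exact hf
  | cons j l ih => exact contDiffOn_pd_iterate hU ih j _

theorem listPd_congr_index {β β' : Fin n → ℕ} {l : List (Fin n)} (h : ∀ i ∈ l, β i = β' i)
    (f : Model n → ℝ) : listPd l β f = listPd l β' f := by
  induction l with
  | nil => rfl
  | cons j l ih =>
    rw [listPd_cons, listPd_cons, h j (by simp), ih fun i hi => h i (by simp [hi])]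

/-- The new derivative commutes past the others until it meets the block of `i`. `Nodup` ensures
there is only one such block, so raising `β i` adds exactly one derivative. -/
theorem pd_listPd (hU : IsOpen U) {f : Model n → ℝ} (hf : ContDiffOn ℝ ∞ f U) (i : Fin n)
    (β : Fin n → ℕ) (l : List (Fin n)) (hl : l.Nodup) (hi : i ∈ l) :
    Set.EqOn (pd i (listPd l β f)) (listPd l (β + Pi.single i 1) f) U := by
  induction l with
  | nil => simp at hi
  | cons j l ih =>
    rw [List.nodup_cons] at hl
    rw [listPd_cons, listPd_cons]
    by_cases hij : i = j
    · subst hij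
      rw [listPd_congr_index (β := β + Pi.single i 1) (β' := β)]
      · simp [Function.iterate_succ_apply', Set.EqOn]
      · intro a ha
        have : a ≠ i := by rintro rfl; exact hl.1 ha
        simp [this]
    · have hi' : i ∈ l := by simpa [hij] using hi
      have hj : (β + Pi.single i 1 : Fin n → ℕ) j = β j := by simp [Ne.symm hij]
      rw [hj]
      exact (pd_pd_iterate_comm hU (contDiffOn_listPd hU hf β l) i j _).trans
        (pd_iterate_congr hU (ih hl.2 hi') j _)

theorem contDiffOn_multiPd (hU : IsOpen U) {f : Model n → ℝ} (hf : ContDiffOn ℝ ∞ f U)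
    (β : Fin n → ℕ) : ContDiffOn ℝ ∞ (multiPd β f) U :=
  contDiffOn_listPd hU hf β _

theorem pd_multiPd (hU : IsOpen U) {f : Model n → ℝ} (hf : ContDiffOn ℝ ∞ f U) (i : Fin n)
    (β : Fin n → ℕ) : Set.EqOn (pd i (multiPd β f)) (multiPd (β + Pi.single i 1) f) U :=
  pd_listPd hU hf i β _ (List.nodup_finRange n) (List.mem_finRange i)

theorem multiPd_zero (f : Model n → ℝ) : multiPd 0 f = f := by
  unfold multiPd
  induction List.finRange n with
  | nil => rfl
  | cons j l _ => simp

theorem contDiffOn_multiPd_entry (hU : IsOpen U) {u : MatrixField n} (hu : IsSmoothSymm U u)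
    (β : Fin n → ℕ) (i j : Fin n) : ContDiffOn ℝ ∞ (multiPd β fun z => u z i j) U :=
  contDiffOn_multiPd hU (hu.1 i j) β

/-- The function `(ξ · (z - y))^p / p!`. -/
def powerFun (y : Model n) (ξ : Fin n → ℝ) (p : ℕ) : Model n → ℝ :=
  fun z => (∑ i, ξ i * (z i - y i)) ^ p / (p.factorial : ℝ)

theorem contDiff_powerFun (y : Model n) (ξ : Fin n → ℝ) (p : ℕ) :
    ContDiff ℝ ∞ (powerFun y ξ p) := by
  unfold powerFun
  fun_prop

theorem pd_powerFun (y : Model n) (ξ : Fin n → ℝ) (p : ℕ) (i : Fin n) (C : ℝ) :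
    pd i (fun z => C * powerFun y ξ (p + 1) z) = fun z => C * ξ i * powerFun y ξ p z := by
  funext z
  have hL : HasFDerivAt (fun z : Model n => ∑ i, ξ i * (z i - y i))
      (∑ i, ξ i • (EuclideanSpace.proj i : Model n →L[ℝ] ℝ)) z := by
    refine HasFDerivAt.fun_sum fun i _ => ?_
    exact (((EuclideanSpace.proj i : Model n →L[ℝ] ℝ).hasFDerivAt).sub_const (y i)).const_mul (ξ i)
  have h := ((hL.pow (p + 1)).mul_const (((p + 1).factorial : ℝ)⁻¹)).const_mul C
  have he : (fun z : Model n => C * powerFun y ξ (p + 1) z) = fun z : Model n =>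
      C * ((∑ i, ξ i * (z i - y i)) ^ (p + 1) * ((p + 1).factorial : ℝ)⁻¹) := by
    funext z; rw [powerFun, div_eq_mul_inv]
  unfold pd
  rw [he, h.fderiv]
  have hp : ((p : ℝ) + 1) ≠ 0 := by positivity
  have hf : (p.factorial : ℝ) ≠ 0 := by positivity
  simp [powerFun, Nat.factorial_succ, PiLp.single_apply]
  field_simp

theorem pd_iterate_powerFun (y : Model n) (ξ : Fin n → ℝ) (i : Fin n) (m p : ℕ) (C : ℝ)
    (h : m ≤ p) :
    (pd i)^[m] (fun z => C * powerFun y ξ p z) = fun z => C * ξ i ^ m * powerFun y ξ (p - m) z := by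
  induction m with
  | zero => simp
  | succ m ih =>
    rw [Function.iterate_succ_apply', ih (by omega)]
    obtain ⟨q, hq⟩ : ∃ q, p - m = q + 1 := ⟨p - m - 1, by omega⟩
    rw [hq, pd_powerFun, show p - (m + 1) = q by omega]
    funext z; ring

/-- Every derivative lowers the exponent by one and the `1/p!` absorbs the numerical factors.
Evaluated at `z = y`, only `|β| = p` survives, with value `C ξ^β`; this is how a symbol is read off
from an operator. -/
theorem multiPd_powerFun (y : Model n) (ξ : Fin n → ℝ) (β : Fin n → ℕ) (p : ℕ) (C : ℝ)
    (h : ∑ i, β i ≤ p) : multiPd β (fun z => C * powerFun y ξ p z) =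
      fun z => C * (∏ i, ξ i ^ β i) * powerFun y ξ (p - ∑ i, β i) z := by
  have key : ∀ l : List (Fin n), (l.map β).sum ≤ p → listPd l β (fun z => C * powerFun y ξ p z) =
      fun z => C * (l.map fun i => ξ i ^ β i).prod * powerFun y ξ (p - (l.map β).sum) z := by
    intro l hl
    induction l with
    | nil => simp [listPd]
    | cons j l ih =>
      simp only [List.map_cons, List.sum_cons, List.prod_cons] at hl ⊢
      rw [listPd_cons, ih (by omega), pd_iterate_powerFun _ _ _ _ _ _ (by omega)]
      funext z
      rw [show p - (l.map β).sum - β j = p - (β j + (l.map β).sum) by omega]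
      ring
  have := key (List.finRange n) (by rwa [← Fin.sum_univ_def])
  rwa [← Fin.sum_univ_def, ← Fin.prod_univ_def] at this

theorem powerFun_self (y : Model n) (ξ : Fin n → ℝ) (p : ℕ) :
    powerFun y ξ p y = if p = 0 then 1 else 0 := by
  by_cases h : p = 0 <;> simp [powerFun, h]

end Calculus

/-! ### Scalar linear differential operators and their top-order symbols. -/

section DiffOp

variable {n : ℕ} {U : Set (Model n)}

/-- `P` is a scalar-valued linear differential operator of order at most `r` on symmetric tensor
fields over `U`, with smooth coefficients, and `τ` is its order `r` symbol (without sign). -/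
def IsScalarDiffOp (U : Set (Model n)) (r : ℕ) (P : MatrixField n → Model n → ℝ)
    (τ : Model n → (Fin n → ℝ) → Matrix (Fin n) (Fin n) ℝ → ℝ) : Prop :=
  ∃ c : (Fin n → ℕ) → Model n → Matrix (Fin n) (Fin n) ℝ →ₗ[ℝ] ℝ,
    (∀ β η, ContDiffOn ℝ ∞ (fun y => c β y η) U) ∧
    (∀ u, IsSmoothSymm U u → ∀ y ∈ U, P u y =
      ∑ d ∈ Finset.range (r + 1), ∑ β ∈ Finset.piAntidiag (Finset.univ : Finset (Fin n)) d,
        c β y (Matrix.of fun i j => multiPd β (fun z => u z i j) y)) ∧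
    ∀ y ∈ U, ∀ ξ η, τ y ξ η =
      ∑ β ∈ Finset.piAntidiag (Finset.univ : Finset (Fin n)) r, (∏ i, ξ i ^ β i) * c β y η

namespace IsScalarDiffOp

variable {r : ℕ} {P Q : MatrixField n → Model n → ℝ}
  {τ τ' : Model n → (Fin n → ℝ) → Matrix (Fin n) (Fin n) ℝ → ℝ}

theorem congr (h : IsScalarDiffOp U r P τ)
    (hPQ : ∀ u, IsSmoothSymm U u → ∀ y ∈ U, Q u y = P u y)
    (hτ : ∀ y ∈ U, ∀ ξ η, τ' y ξ η = τ y ξ η) : IsScalarDiffOp U r Q τ' := by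
  obtain ⟨c, hc, hP, hs⟩ := h
  refine ⟨c, hc, fun u hu y hy => by rw [hPQ u hu y hy, hP u hu y hy], fun y hy ξ η => by
    rw [hτ y hy, hs y hy]⟩

theorem zero : IsScalarDiffOp U r (fun _ _ => 0) (fun _ _ _ => 0) :=
  ⟨fun _ _ => 0, fun _ _ => by simpa using contDiffOn_const, by simp, by simp⟩

theorem add (hP : IsScalarDiffOp U r P τ) (hQ : IsScalarDiffOp U r Q τ') :
    IsScalarDiffOp U r (fun u y => P u y + Q u y) (fun y ξ η => τ y ξ η + τ' y ξ η) := by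
  obtain ⟨c, hc, hP, hs⟩ := hP
  obtain ⟨c', hc', hP', hs'⟩ := hQ
  refine ⟨fun β y => c β y + c' β y, fun β η => (hc β η).add (hc' β η), fun u hu y hy => ?_,
    fun y hy ξ η => ?_⟩
  · beta_reduce
    rw [hP u hu y hy, hP' u hu y hy]
    simp [Finset.sum_add_distrib]
  · beta_reduce
    rw [hs y hy, hs' y hy]
    simp [Finset.sum_add_distrib, mul_add]

theorem sum {ι : Type*} (s : Finset ι) {P : ι → MatrixField n → Model n → ℝ}
    {τ : ι → Model n → (Fin n → ℝ) → Matrix (Fin n) (Fin n) ℝ → ℝ}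
    (h : ∀ a ∈ s, IsScalarDiffOp U r (P a) (τ a)) :
    IsScalarDiffOp U r (fun u y => ∑ a ∈ s, P a u y) (fun y ξ η => ∑ a ∈ s, τ a y ξ η) := by
  classical
  induction s using Finset.induction_on with
  | empty => simpa using zero
  | insert a s ha ih =>
    simp only [Finset.sum_insert ha]
    exact (h a (by simp)).add (ih fun b hb => h b (by simp [hb]))

theorem smul {f : Model n → ℝ} (hf : ContDiffOn ℝ ∞ f U) (hP : IsScalarDiffOp U r P τ) :
    IsScalarDiffOp U r (fun u y => f y * P u y) (fun y ξ η => f y * τ y ξ η) := by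
  obtain ⟨c, hc, hP, hs⟩ := hP
  refine ⟨fun β y => f y • c β y, fun β η => hf.mul (hc β η), fun u hu y hy => ?_,
    fun y hy ξ η => ?_⟩
  · beta_reduce
    rw [hP u hu y hy]
    simp [Finset.mul_sum]
  · beta_reduce
    rw [hs y hy]
    simp only [Finset.mul_sum, LinearMap.smul_apply, smul_eq_mul]
    exact Finset.sum_congr rfl fun _ _ => by ring

theorem sum_degree_eq {r : ℕ} {β : Fin n → ℕ} (hβ : ∑ i, β i ≤ r) (F : (Fin n → ℕ) → ℝ)
    (hF : ∀ γ, γ ≠ β → F γ = 0) :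
    ∑ d ∈ Finset.range (r + 1), ∑ γ ∈ Finset.piAntidiag (Finset.univ : Finset (Fin n)) d, F γ =
      F β := by
  rw [Finset.sum_eq_single (∑ i, β i), Finset.sum_eq_single β]
  · intro γ _ h; exact hF γ h
  · intro h; simp at h
  · intro d _ hd
    refine Finset.sum_eq_zero fun γ hγ => hF γ ?_
    rintro rfl
    exact hd (by simpa using (Finset.mem_piAntidiag.1 hγ).1.symm)
  · intro h; simp at h; omega

theorem sum_top_eq {r : ℕ} {β : Fin n → ℕ} (F : (Fin n → ℕ) → ℝ)
    (hF : ∀ γ, γ ≠ β → F γ = 0) :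
    ∑ γ ∈ Finset.piAntidiag (Finset.univ : Finset (Fin n)) r, F γ =
      if ∑ i, β i = r then F β else 0 := by
  split_ifs with h
  · refine Finset.sum_eq_single β (fun γ _ h => hF γ h) fun h' => ?_
    simp [h] at h'
  · refine Finset.sum_eq_zero fun γ hγ => hF γ ?_
    rintro rfl
    exact h (Finset.mem_piAntidiag.1 hγ).1

theorem single {f : Model n → ℝ} (hf : ContDiffOn ℝ ∞ f U) {β : Fin n → ℕ} (hβ : ∑ i, β i ≤ r)
    (i j : Fin n) : IsScalarDiffOp U r (fun u y => f y * multiPd β (fun z => u z i j) y)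
      (fun y ξ η => if ∑ i, β i = r then (∏ i, ξ i ^ β i) * (f y * η i j) else 0) := by
  classical
  refine ⟨fun γ y => if γ = β then f y • (Matrix.entryLinearMap ℝ ℝ i j) else 0, fun γ η => ?_,
    fun u hu y hy => ?_, fun y hy ξ η => ?_⟩
  · by_cases h : γ = β
    · simpa [h] using hf.mul contDiffOn_const
    · simpa [h] using contDiffOn_const
  · rw [sum_degree_eq hβ _ fun γ hγ => by simp [hγ]]
    simp
  · rw [sum_top_eq (β := β) _ fun γ hγ => by simp [hγ]]
    simp

theorem of_lt {r' : ℕ} (h : r < r') (hP : IsScalarDiffOp U r P τ) :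
    IsScalarDiffOp U r' P (fun _ _ _ => 0) := by
  classical
  obtain ⟨c, hc, hP, hs⟩ := hP
  have hdeg : ∀ {d : ℕ} {β : Fin n → ℕ},
      β ∈ Finset.piAntidiag (Finset.univ : Finset (Fin n)) d → ∑ i, β i = d :=
    fun hβ => (Finset.mem_piAntidiag.1 hβ).1
  -- The coefficients of index `|β| > r` are arbitrary in the data for order `r`, so they must be
  -- cut off before the order is raised.
  refine ⟨fun β y => if ∑ i, β i ≤ r then c β y else 0, fun β η => ?_, fun u hu y hy => ?_,
    fun y hy ξ η => ?_⟩
  · by_cases h : ∑ i, β i ≤ r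
    · simpa [h] using hc β η
    · simpa [h] using contDiffOn_const
  · rw [hP u hu y hy]
    refine (Finset.sum_congr rfl fun d hd => Finset.sum_congr rfl fun β hβ => ?_).trans
      (Finset.sum_subset (Finset.range_subset_range.2 (by omega : r + 1 ≤ r' + 1)) fun d _ hd => ?_)
    · beta_reduce
      rw [if_pos]
      rw [hdeg hβ]; simp at hd; omega
    · refine Finset.sum_eq_zero fun β hβ => ?_
      beta_reduce
      rw [if_neg]; · simp
      rw [hdeg hβ]; simpa using hd
  · refine (Finset.sum_eq_zero fun β hβ => ?_).symm
    beta_reduce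
    rw [if_neg]; · simp
    rw [hdeg hβ]; omega

/-- Expansion in matrix units turns matrix-valued coefficients into scalar functions, to which the
product rule applies. -/
theorem matrix_sum_eq (L : Matrix (Fin n) (Fin n) ℝ →ₗ[ℝ] ℝ) (η : Matrix (Fin n) (Fin n) ℝ) :
    L η = ∑ i, ∑ j, L (Matrix.single i j 1) * η i j := by
  conv_lhs => rw [Matrix.matrix_eq_sum_single η]
  simp only [map_sum]
  refine Finset.sum_congr rfl fun i _ => Finset.sum_congr rfl fun j _ => ?_
  rw [← mul_one (η i j), ← smul_eq_mul (η i j), ← Matrix.smul_single, map_smul, smul_eq_mul,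
    smul_eq_mul]
  ring

/-- Leibniz: `∂_m (c_β D^β u) = (∂_m c_β) D^β u + c_β D^(β+e_m) u`. Only the second summand with
`|β| = r` reaches order `r + 1`, which multiplies the symbol by `ξ_m`. -/
theorem pd (hU : IsOpen U) (hP : IsScalarDiffOp U r P τ) (m : Fin n) :
    IsScalarDiffOp U (r + 1) (fun u => TensorFlow.pd m (P u))
      (fun y ξ η => ξ m * τ y ξ η) := by
  classical
  obtain ⟨c, hc, hP, hs⟩ := hP
  have main := sum (r := r + 1) (U := U) (Finset.range (r + 1)) fun d hd =>
    sum (r := r + 1) (Finset.piAntidiag (Finset.univ : Finset (Fin n)) d) fun β hβ =>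
    sum (r := r + 1) (Finset.univ : Finset (Fin n)) fun i _ =>
    sum (r := r + 1) (Finset.univ : Finset (Fin n)) fun j _ =>
      (single (contDiffOn_pd hU (hc β (Matrix.single i j 1)) m) (β := β) (r := r + 1) (by
        rw [(Finset.mem_piAntidiag.1 hβ).1]; simp at hd; omega) i j).add
      (single (hc β (Matrix.single i j 1)) (β := β + Pi.single m 1) (r := r + 1) (by
        simp only [Pi.add_apply, Finset.sum_add_distrib, Finset.sum_pi_single', Finset.mem_univ,
          if_true]
        rw [(Finset.mem_piAntidiag.1 hβ).1]; simp at hd; omega) i j)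
  refine main.congr ?_ ?_
  · intro u hu y hy
    have hd : ∀ β i j, DifferentiableAt ℝ
        (fun z => c β z (Matrix.single i j 1) * multiPd β (fun z => u z i j) z) y := fun β i j =>
      (differentiableAt_of_contDiffOn hU (hc β _) hy).mul
        (differentiableAt_of_contDiffOn hU (contDiffOn_multiPd_entry hU hu β i j) hy)
    have he : Set.EqOn (P u) (fun y => ∑ d ∈ Finset.range (r + 1),
        ∑ β ∈ Finset.piAntidiag (Finset.univ : Finset (Fin n)) d, ∑ i, ∑ j,
          c β y (Matrix.single i j 1) * multiPd β (fun z => u z i j) y) U := by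
      intro z hz
      rw [hP u hu z hz]
      refine Finset.sum_congr rfl fun d _ => Finset.sum_congr rfl fun β _ => ?_
      rw [matrix_sum_eq]
      rfl
    rw [pd_congr hU he m hy]
    rw [pd_sum _ fun d _ => DifferentiableAt.fun_sum fun β _ => DifferentiableAt.fun_sum fun i _ =>
      DifferentiableAt.fun_sum fun j _ => hd β i j]
    refine Finset.sum_congr rfl fun d _ => ?_
    rw [pd_sum _ fun β _ => DifferentiableAt.fun_sum fun i _ =>
      DifferentiableAt.fun_sum fun j _ => hd β i j]
    refine Finset.sum_congr rfl fun β _ => ?_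
    rw [pd_sum _ fun i _ => DifferentiableAt.fun_sum fun j _ => hd β i j]
    refine Finset.sum_congr rfl fun i _ => ?_
    rw [pd_sum _ fun j _ => hd β i j]
    refine Finset.sum_congr rfl fun j _ => ?_
    rw [pd_mul (differentiableAt_of_contDiffOn hU (hc β _) hy)
      (differentiableAt_of_contDiffOn hU (contDiffOn_multiPd_entry hU hu β i j) hy),
      pd_multiPd hU (hu.1 i j) m β hy]
  · intro y hy ξ η
    rw [hs y hy, Finset.mul_sum]
    symm
    rw [Finset.sum_range_succ, Finset.sum_eq_zero, zero_add]
    · refine Finset.sum_congr rfl fun β hβ => ?_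
      rw [matrix_sum_eq]
      have hb := (Finset.mem_piAntidiag.1 hβ).1
      have hprod : ∏ i, ξ i ^ (β + Pi.single m 1 : Fin n → ℕ) i = ξ m * ∏ i, ξ i ^ β i := by
        simp only [Pi.add_apply, pow_add, Finset.prod_mul_distrib]
        rw [mul_comm]
        congr 1
        rw [Finset.prod_eq_single m] <;> simp +contextual
      simp only [Pi.add_apply, Finset.sum_add_distrib, Finset.sum_pi_single', Finset.mem_univ,
          if_true, hb]
      simp only [Nat.left_eq_add, one_ne_zero, if_false, zero_add, Finset.sum_const_zero]
      simp only [← Pi.add_apply, hprod, Finset.mul_sum]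
      exact Finset.sum_congr rfl fun i _ => Finset.sum_congr rfl fun j _ => by ring
    · intro d hd
      refine Finset.sum_eq_zero fun β hβ => ?_
      have hb := (Finset.mem_piAntidiag.1 hβ).1
      simp only [Finset.mem_range] at hd
      simp only [Pi.add_apply, Finset.sum_add_distrib, Finset.sum_pi_single', Finset.mem_univ,
          if_true, hb]
      simp [show d ≠ r + 1 by omega, show d ≠ r by omega]

end IsScalarDiffOp

end DiffOp

/-! ### Symbol calculus for linearizations of functionals of a metric. -/

section Lin

variable {n : ℕ} {U : Set (Model n)} {g : MatrixField n}

/-- The functional `F` of a metric depends smoothly on the parameters of the families `g + s u` near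
`s = 0`, and its derivative at `g` in the direction `u` is a linear differential operator in `u` of
order at most `r`, with smooth coefficients and order `r` symbol `τ`. -/
def HasSymbol (U : Set (Model n)) (g : MatrixField n) (F : MatrixField n → Model n → ℝ) (r : ℕ)
    (τ : Model n → (Fin n → ℝ) → Matrix (Fin n) (Fin n) ℝ → ℝ) : Prop :=
  ∃ P, IsScalarDiffOp U r P τ ∧ ∀ u, IsSmoothSymm U u → ∀ y ∈ U,
    ContDiffAt ℝ ∞ (fun p : ℝ × Model n => F (g + p.1 • u) p.2) (0, y) ∧
    deriv (fun s : ℝ => F (g + s • u) y) 0 = P u y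

theorem isSmoothSymm_zero : IsSmoothSymm U (0 : MatrixField n) :=
  ⟨fun _ _ => by simpa using contDiffOn_const, fun _ _ => by simp [Matrix.IsSymm]⟩

theorem family_apply (g u : MatrixField n) (s : ℝ) (z : Model n) (i j : Fin n) :
    (g + s • u) z i j = g z i j + s * u z i j := by
  simp

theorem contDiffAt_family_slice {F : MatrixField n → Model n → ℝ} {u : MatrixField n}
    {y : Model n} (h : ContDiffAt ℝ ∞ (fun p : ℝ × Model n => F (g + p.1 • u) p.2) (0, y)) :
    ContDiffAt ℝ ∞ (fun s : ℝ => F (g + s • u) y) 0 :=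
  h.comp (f := fun s : ℝ => (s, y)) (0 : ℝ) (contDiffAt_id.prodMk contDiffAt_const)

theorem differentiableAt_family_slice {F : MatrixField n → Model n → ℝ} {u : MatrixField n}
    {y : Model n} (h : ContDiffAt ℝ ∞ (fun p : ℝ × Model n => F (g + p.1 • u) p.2) (0, y)) :
    DifferentiableAt ℝ (fun s : ℝ => F (g + s • u) y) 0 :=
  (contDiffAt_family_slice h).differentiableAt (by simp)

/-- Applied with `Ψ` the Fréchet derivative of a function of `(s, y)`: together with
`hasFDerivAt_slice` it identifies both iterated partial derivatives with values of one second
derivative. -/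
theorem hasDerivAt_slice {E : Type*} [NormedAddCommGroup E] [NormedSpace ℝ E]
    {Ψ : ℝ × E → ℝ × E →L[ℝ] ℝ} {Ψ' : ℝ × E →L[ℝ] ℝ × E →L[ℝ] ℝ} {s : ℝ} {y : E}
    (h : HasFDerivAt Ψ Ψ' (s, y)) (v : ℝ × E) :
    HasDerivAt (fun s : ℝ => Ψ (s, y) v) (Ψ' (1, 0) v) s := by
  have h1 : HasDerivAt (fun s : ℝ => (s, y)) ((1 : ℝ), (0 : E)) s :=
    (hasDerivAt_id _).prodMk (hasDerivAt_const _ _)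
  have h2 : HasDerivAt (fun s : ℝ => Ψ (s, y)) (Ψ' (1, 0)) s := h.comp_hasDerivAt s h1
  simpa using h2.clm_apply (hasDerivAt_const s v)

theorem hasFDerivAt_slice {E : Type*} [NormedAddCommGroup E] [NormedSpace ℝ E]
    {Ψ : ℝ × E → ℝ × E →L[ℝ] ℝ} {Ψ' : ℝ × E →L[ℝ] ℝ × E →L[ℝ] ℝ} {s : ℝ} {y : E}
    (h : HasFDerivAt Ψ Ψ' (s, y)) (v : ℝ × E) :
    HasFDerivAt (fun z : E => Ψ (s, z) v)
      ((ContinuousLinearMap.apply ℝ ℝ v).comp (Ψ'.comp (ContinuousLinearMap.inr ℝ ℝ E))) y := by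
  have h1 : HasFDerivAt (fun z : E => (s, z)) (ContinuousLinearMap.inr ℝ ℝ E) y :=
    hasFDerivAt_prodMk_right _ _
  have h2 : HasFDerivAt (fun z : E => Ψ (s, z)) (Ψ'.comp (ContinuousLinearMap.inr ℝ ℝ E)) y :=
    h.comp y h1
  exact (ContinuousLinearMap.apply ℝ ℝ v).hasFDerivAt.comp y h2

namespace HasSymbol

variable {r : ℕ} {F G : MatrixField n → Model n → ℝ}
  {τ τ' : Model n → (Fin n → ℝ) → Matrix (Fin n) (Fin n) ℝ → ℝ}

theorem congr_symbol (h : HasSymbol U g F r τ)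
    (hτ : ∀ y ∈ U, ∀ ξ η, τ' y ξ η = τ y ξ η) : HasSymbol U g F r τ' := by
  obtain ⟨P, hP, h⟩ := h
  exact ⟨P, hP.congr (fun _ _ _ _ => rfl) hτ, h⟩

theorem congr_fun (h : HasSymbol U g F r τ) (hFG : ∀ g', G g' = F g') : HasSymbol U g G r τ := by
  rwa [funext hFG]

/-- The direction `u = 0` extracts smoothness of `F g` itself, which is needed because `F g` appears
as a coefficient in the product rule. -/
theorem contDiffOn (h : HasSymbol U g F r τ) : ContDiffOn ℝ ∞ (F g) U := by
  obtain ⟨P, -, h⟩ := h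
  intro y hy
  have := (h 0 isSmoothSymm_zero y hy).1
  simp only [smul_zero, add_zero] at this
  exact (this.comp (f := fun z : Model n => ((0 : ℝ), z)) y
    (contDiffAt_const.prodMk contDiffAt_id)).contDiffWithinAt

theorem of_lt {r' : ℕ} (hr : r < r') (h : HasSymbol U g F r τ) :
    HasSymbol U g F r' (fun _ _ _ => 0) := by
  obtain ⟨P, hP, h⟩ := h
  exact ⟨P, hP.of_lt hr, h⟩

theorem const {f : Model n → ℝ} (hf : ContDiffOn ℝ ∞ f U) (hU : IsOpen U) :
    HasSymbol U g (fun _ => f) r (fun _ _ _ => 0) :=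
  ⟨_, .zero, fun _ _ y hy => ⟨(hf.contDiffAt (hU.mem_nhds hy)).comp
    (f := fun p : ℝ × Model n => p.2) (0, y) contDiffAt_snd, by simp⟩⟩

theorem add (hF : HasSymbol U g F r τ) (hG : HasSymbol U g G r τ') :
    HasSymbol U g (fun g' y => F g' y + G g' y) r (fun y ξ η => τ y ξ η + τ' y ξ η) := by
  obtain ⟨P, hP, hF⟩ := hF
  obtain ⟨Q, hQ, hG⟩ := hG
  refine ⟨_, hP.add hQ, fun u hu y hy => ⟨(hF u hu y hy).1.add (hG u hu y hy).1, ?_⟩⟩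
  rw [deriv_fun_add (differentiableAt_family_slice (hF u hu y hy).1)
    (differentiableAt_family_slice (hG u hu y hy).1), (hF u hu y hy).2, (hG u hu y hy).2]

theorem mul (hF : HasSymbol U g F r τ) (hG : HasSymbol U g G r τ') :
    HasSymbol U g (fun g' y => F g' y * G g' y) r
      (fun y ξ η => G g y * τ y ξ η + F g y * τ' y ξ η) := by
  have hFc := hF.contDiffOn
  have hGc := hG.contDiffOn
  obtain ⟨P, hP, hF⟩ := hF
  obtain ⟨Q, hQ, hG⟩ := hG
  refine ⟨_, (hP.smul hGc).add (hQ.smul hFc),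
    fun u hu y hy => ⟨(hF u hu y hy).1.mul (hG u hu y hy).1, ?_⟩⟩
  rw [deriv_fun_mul (differentiableAt_family_slice (hF u hu y hy).1)
    (differentiableAt_family_slice (hG u hu y hy).1), (hF u hu y hy).2, (hG u hu y hy).2]
  simp only [zero_smul, add_zero]
  ring

theorem const_mul (hU : IsOpen U) (c : ℝ) (hF : HasSymbol U g F r τ) :
    HasSymbol U g (fun g' y => c * F g' y) r (fun y ξ η => c * τ y ξ η) :=
  ((const (contDiffOn_const (c := c)) hU).mul hF).congr_symbol fun _ _ _ _ => by simp

theorem neg (hU : IsOpen U) (hF : HasSymbol U g F r τ) :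
    HasSymbol U g (fun g' y => -F g' y) r (fun y ξ η => -τ y ξ η) := by
  simpa using hF.const_mul hU (-1)

theorem sub (hU : IsOpen U) (hF : HasSymbol U g F r τ) (hG : HasSymbol U g G r τ') :
    HasSymbol U g (fun g' y => F g' y - G g' y) r (fun y ξ η => τ y ξ η - τ' y ξ η) := by
  simpa [sub_eq_add_neg] using hF.add (hG.neg hU)

theorem sum (hU : IsOpen U) {ι : Type*} (s : Finset ι) {F : ι → MatrixField n → Model n → ℝ}
    {τ : ι → Model n → (Fin n → ℝ) → Matrix (Fin n) (Fin n) ℝ → ℝ}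
    (h : ∀ a, HasSymbol U g (F a) r (τ a)) :
    HasSymbol U g (fun g' y => ∑ a ∈ s, F a g' y) r (fun y ξ η => ∑ a ∈ s, τ a y ξ η) := by
  classical
  induction s using Finset.induction_on with
  | empty => simpa using const contDiffOn_const hU
  | insert a s ha ih =>
    simp only [Finset.sum_insert ha]
    exact (h a).add ih

theorem mul_zero (hF : HasSymbol U g F r fun _ _ _ => 0)
    (hG : HasSymbol U g G r fun _ _ _ => 0) :
    HasSymbol U g (fun g' y => F g' y * G g' y) r fun _ _ _ => 0 :=
  (hF.mul hG).congr_symbol fun _ _ _ _ => by simp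

theorem sum_zero (hU : IsOpen U) {ι : Type*} (s : Finset ι)
    {F : ι → MatrixField n → Model n → ℝ} (h : ∀ a, HasSymbol U g (F a) r fun _ _ _ => 0) :
    HasSymbol U g (fun g' y => ∑ a ∈ s, F a g' y) r fun _ _ _ => 0 :=
  (sum hU s h).congr_symbol fun _ _ _ _ => by simp

/-- Multiplication by a functional of lower order. -/
theorem mul_left_zero (hF : HasSymbol U g F r fun _ _ _ => 0)
    (hG : HasSymbol U g G r τ) :
    HasSymbol U g (fun g' y => F g' y * G g' y) r (fun y ξ η => F g y * τ y ξ η) :=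
  (hF.mul hG).congr_symbol fun _ _ _ _ => by simp

theorem entry (hU : IsOpen U) (hg : IsSmoothSymm U g) (i j : Fin n) :
    HasSymbol U g (fun g' y => g' y i j) 0 (fun _ _ η => η i j) := by
  refine ⟨_, (IsScalarDiffOp.single (contDiffOn_const (c := 1)) (β := 0) (by simp) i j).congr
    (Q := fun u y => u y i j) ?_ ?_, fun u hu y hy => ⟨?_, ?_⟩⟩
  · intro u _ y _
    simp [multiPd_zero]
  · intro y _ ξ η; simp
  · simp only [family_apply]
    refine ContDiffAt.add ?_ (contDiffAt_fst.mul ?_)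
    · exact ((hg.1 i j).contDiffAt (hU.mem_nhds hy)).comp
        (f := fun p : ℝ × Model n => p.2) (0, y) contDiffAt_snd
    · exact ((hu.1 i j).contDiffAt (hU.mem_nhds hy)).comp
        (f := fun p : ℝ × Model n => p.2) (0, y) contDiffAt_snd
  · simp only [family_apply]
    simp

theorem contDiffAt_det {E : Type*} [NormedAddCommGroup E] [NormedSpace ℝ E] {m : ℕ}
    {A : E → Matrix (Fin m) (Fin m) ℝ} {x : E} (h : ∀ i j, ContDiffAt ℝ ∞ (fun p => A p i j) x) :
    ContDiffAt ℝ ∞ (fun p => (A p).det) x := by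
  simp only [Matrix.det_apply]
  exact ContDiffAt.sum fun σ _ => (contDiffAt_prod fun i _ => h _ _).const_smul _

theorem contDiffAt_inv {E : Type*} [NormedAddCommGroup E] [NormedSpace ℝ E] {m : ℕ}
    {A : E → Matrix (Fin m) (Fin m) ℝ} {x : E} (h : ∀ i j, ContDiffAt ℝ ∞ (fun p => A p i j) x)
    (hx : (A x).det ≠ 0) (i j : Fin m) : ContDiffAt ℝ ∞ (fun p => (A p)⁻¹ i j) x := by
  simp only [Matrix.inv_def, Ring.inverse_eq_inv', Matrix.smul_apply, smul_eq_mul,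
    Matrix.adjugate_apply]
  refine ((contDiffAt_det h).inv hx).mul (contDiffAt_det fun a b => ?_)
  simp only [Matrix.updateRow_apply]
  split_ifs
  · exact contDiffAt_const
  · exact h a b

/-- Differentiate `A A⁻¹ = 1`, which holds for `s` near `0` because the determinant stays nonzero,
and multiply by `A⁻¹` on the left. -/
theorem hasDerivAt_inv {m : ℕ} {A : ℝ → Matrix (Fin m) (Fin m) ℝ} {B : Matrix (Fin m) (Fin m) ℝ}
    (h : ∀ i j, ContDiffAt ℝ ∞ (fun s => A s i j) 0)
    (hB : ∀ i j, deriv (fun s => A s i j) 0 = B i j) (hx : (A 0).det ≠ 0) (i j : Fin m) :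
    deriv (fun s => (A s)⁻¹ i j) 0 = -((A 0)⁻¹ * B * (A 0)⁻¹) i j := by
  set X' : Matrix (Fin m) (Fin m) ℝ := Matrix.of fun i j => deriv (fun s => (A s)⁻¹ i j) 0 with hX'
  have hA : ∀ i j, DifferentiableAt ℝ (fun s => A s i j) 0 := fun i j =>
    (h i j).differentiableAt (by simp)
  have hX : ∀ i j, DifferentiableAt ℝ (fun s => (A s)⁻¹ i j) 0 := fun i j =>
    (contDiffAt_inv h hx i j).differentiableAt (by simp)
  have hne : ∀ᶠ s in nhds (0 : ℝ), (A s).det ≠ 0 :=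
    (contDiffAt_det h).continuousAt.eventually_ne hx
  have key : B * (A 0)⁻¹ + A 0 * X' = 0 := by
    ext i k
    have h1 : (fun s => ∑ j, A s i j * (A s)⁻¹ j k) =ᶠ[nhds 0]
        fun _ => (1 : Matrix (Fin m) (Fin m) ℝ) i k := by
      filter_upwards [hne] with s hs
      rw [← Matrix.mul_apply, Matrix.mul_nonsing_inv _ (isUnit_iff_ne_zero.2 hs)]
    have h2 := h1.deriv_eq
    rw [deriv_fun_sum fun j _ => (hA i j).fun_mul (hX j k)] at h2
    simp only [deriv_const] at h2
    rw [Finset.sum_congr rfl fun j _ => deriv_fun_mul (hA i j) (hX j k)] at h2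
    simp only [hB, Finset.sum_add_distrib] at h2
    simpa [Matrix.mul_apply, hX'] using h2
  have hu : IsUnit (A 0).det := isUnit_iff_ne_zero.2 hx
  have : X' = -((A 0)⁻¹ * B * (A 0)⁻¹) := by
    have := congrArg (fun Y => (A 0)⁻¹ * Y) key
    simp only [mul_add, Matrix.mul_zero, ← mul_assoc, Matrix.nonsing_inv_mul _ hu, one_mul] at this
    exact eq_neg_of_add_eq_zero_right this
  exact congrFun (congrFun this i) j

/-- The linearization `u ↦ -g⁻¹ u g⁻¹` has order `0`, so it is invisible at any order `r + 1`. -/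
theorem inv (hU : IsOpen U) (hg : IsLocalMetric U g) (i j : Fin n) :
    HasSymbol U g (fun g' y => (g' y)⁻¹ i j) (r + 1) (fun _ _ _ => 0) := by
  have hdet : ∀ y ∈ U, (g y).det ≠ 0 := fun y hy => (hg.2 y hy).det_pos.ne'
  have hgi : ∀ i j, ContDiffOn ℝ ∞ (fun y => (g y)⁻¹ i j) U := fun i j y hy =>
    (contDiffAt_inv (fun i j => (hg.1.1 i j).contDiffAt (hU.mem_nhds hy))
      (hdet y hy) i j).contDiffWithinAt
  have hsm : ∀ u, IsSmoothSymm U u → ∀ y ∈ U, ∀ i j,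
      ContDiffAt ℝ ∞ (fun p : ℝ × Model n => (g + p.1 • u) p.2 i j) (0, y) := by
    intro u hu y hy i j
    obtain ⟨P, -, h⟩ := entry hU hg.1 i j
    exact (h u hu y hy).1
  refine ⟨fun u y => -((g y)⁻¹ * u y * (g y)⁻¹) i j, ?_, fun u hu y hy => ⟨?_, ?_⟩⟩
  · have main := IsScalarDiffOp.sum (U := U) (r := r + 1) (Finset.univ : Finset (Fin n)) fun b _ =>
      IsScalarDiffOp.sum (r := r + 1) (Finset.univ : Finset (Fin n)) fun a _ =>
      IsScalarDiffOp.single (f := fun y => -((g y)⁻¹ i a * (g y)⁻¹ b j))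
        ((hgi i a).mul (hgi b j)).neg (β := 0) (r := r + 1) (by simp) a b
    refine main.congr ?_ ?_
    · intro u hu y hy
      simp only [Matrix.mul_apply, multiPd_zero, Finset.sum_mul,
        Finset.sum_neg_distrib, neg_mul]
      congr 1
      exact Finset.sum_congr rfl fun _ _ => Finset.sum_congr rfl fun _ _ => by ring
    · intro y _ ξ η; simp
  · exact contDiffAt_inv (hsm u hu y hy) (by simpa using hdet y hy) i j
  · have := hasDerivAt_inv (A := fun s => (g + s • u) y) (B := u y)
      (fun i j => contDiffAt_family_slice (F := fun g' y => g' y i j) (hsm u hu y hy i j))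
      (fun i j => by simp only [family_apply]; simp) (by simpa using hdet y hy) i j
    simpa using this

/-- The derivatives `∂_s` and `∂_m` of `Φ(s, z) = F(g + s u)(z)` commute. This is why `HasSymbol`
demands joint smoothness in `(s, z)`. -/
theorem pd (hU : IsOpen U) (hF : HasSymbol U g F r τ) (m : Fin n) :
    HasSymbol U g (fun g' => TensorFlow.pd m (F g')) (r + 1) (fun y ξ η => ξ m * τ y ξ η) := by
  obtain ⟨P, hP, hF⟩ := hF
  refine ⟨_, hP.pd hU m, fun u hu y hy => ?_⟩
  set Φ : ℝ × Model n → ℝ := fun p => F (g + p.1 • u) p.2 with hΦ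
  have hsm : ContDiffAt ℝ ∞ Φ (0, y) := (hF u hu y hy).1
  set e : Model n := EuclideanSpace.single m 1
  have hD : ContDiffAt ℝ ∞ (fderiv ℝ Φ) (0, y) := hsm.fderiv_right (m := ∞) le_rfl
  have hdiff : ∀ᶠ p in nhds ((0 : ℝ), y), DifferentiableAt ℝ Φ p := by
    filter_upwards [(hsm.of_le (m := 1) ENat.LEInfty.out).eventually (by simp)] with p hp
    exact hp.differentiableAt (by simp)
  have hpd : ∀ p : ℝ × Model n, DifferentiableAt ℝ Φ p →
      TensorFlow.pd m (F (g + p.1 • u)) p.2 = fderiv ℝ Φ p (0, e) := by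
    intro p hp
    have h1 : HasFDerivAt (fun z : Model n => (p.1, z))
        (ContinuousLinearMap.inr ℝ ℝ (Model n)) p.2 := hasFDerivAt_prodMk_right _ _
    have h2 : HasFDerivAt Φ (fderiv ℝ Φ p) (p.1, p.2) := hp.hasFDerivAt
    have := (h2.comp (f := fun z : Model n => (p.1, z)) p.2 h1).fderiv
    unfold TensorFlow.pd
    change fderiv ℝ (Φ ∘ fun z : Model n => (p.1, z)) p.2 e = _
    rw [this]; simp
  have hds : ∀ z : Model n, DifferentiableAt ℝ Φ (0, z) →
      deriv (fun s : ℝ => F (g + s • u) z) 0 = fderiv ℝ Φ (0, z) (1, 0) := by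
    intro z hz
    have h1 : HasDerivAt (fun s : ℝ => (s, z)) ((1 : ℝ), (0 : Model n)) 0 :=
      (hasDerivAt_id _).prodMk (hasDerivAt_const _ _)
    exact (hz.hasFDerivAt.comp_hasDerivAt (0 : ℝ) h1).deriv
  have heq : (fun p : ℝ × Model n => TensorFlow.pd m (F (g + p.1 • u)) p.2) =ᶠ[nhds (0, y)]
      fun p => fderiv ℝ Φ p (0, e) := by
    filter_upwards [hdiff] with p hp using hpd p hp
  refine ⟨(hD.clm_apply contDiffAt_const).congr_of_eventuallyEq heq, ?_⟩
  have hD' : HasFDerivAt (fderiv ℝ Φ) (fderiv ℝ (fderiv ℝ Φ) (0, y)) (0, y) :=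
    (hD.differentiableAt (by simp)).hasFDerivAt
  have hc1 : Filter.Tendsto (fun s : ℝ => (s, y)) (nhds 0) (nhds (0, y)) :=
    (Continuous.prodMk_left y).tendsto' _ _ rfl
  have hc2 : Filter.Tendsto (fun z : Model n => ((0 : ℝ), z)) (nhds y) (nhds (0, y)) :=
    (Continuous.prodMk_right (0 : ℝ)).tendsto' _ _ rfl
  have hL : deriv (fun s : ℝ => TensorFlow.pd m (F (g + s • u)) y) 0 =
      fderiv ℝ (fderiv ℝ Φ) (0, y) (1, 0) (0, e) := by
    refine (heq.comp_tendsto hc1).deriv_eq.trans ?_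
    exact (hasDerivAt_slice hD' (0, e)).deriv
  have hR : TensorFlow.pd m (P u) y = fderiv ℝ (fderiv ℝ Φ) (0, y) (0, e) (1, 0) := by
    -- To differentiate `P u` in space, its identity with `∂_s Φ(0, ·)` is needed on a neighbourhood
    -- of `y`, not only at `y`.
    have he : P u =ᶠ[nhds y] fun z => fderiv ℝ Φ (0, z) (1, 0) := by
      filter_upwards [hU.mem_nhds hy, hc2.eventually hdiff] with z hz hdz
      rw [← hds z hdz, (hF u hu z hz).2]
    rw [pd_congr_nhds he m]
    unfold TensorFlow.pd
    rw [(hasFDerivAt_slice hD' (1, 0)).fderiv]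
    rfl
  rw [hL, hR]
  exact hsm.isSymmSndFDerivAt (by
    rw [minSmoothness_of_isRCLikeNormedField]; exact ENat.LEInfty.out) _ _

theorem multiPd (hU : IsOpen U) (hg : IsSmoothSymm U g) (i j : Fin n) (β : Fin n → ℕ) :
    ∃ τ, HasSymbol U g (fun g' => TensorFlow.multiPd β fun z => g' z i j) (∑ i, β i) τ := by
  have iter : ∀ (m : ℕ) (a : Fin n) (F : MatrixField n → Model n → ℝ) (r : ℕ)
      (τ : Model n → (Fin n → ℝ) → Matrix (Fin n) (Fin n) ℝ → ℝ), HasSymbol U g F r τ →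
      ∃ τ, HasSymbol U g (fun g' => (TensorFlow.pd a)^[m] (F g')) (m + r) τ := by
    intro m a F r τ hF
    induction m with
    | zero => exact ⟨τ, by simpa using hF⟩
    | succ m ih =>
      obtain ⟨τ', h⟩ := ih
      simp only [Function.iterate_succ_apply']
      exact ⟨_, by simpa [add_right_comm] using h.pd hU a⟩
  have key : ∀ l : List (Fin n), ∃ τ, HasSymbol U g
      (fun g' => listPd l β fun z => g' z i j) (l.map β).sum τ := by
    intro l
    induction l with
    | nil => exact ⟨_, entry hU hg i j⟩
    | cons a l ih =>
      obtain ⟨τ, h⟩ := ih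
      simp only [List.map_cons, List.sum_cons]
      exact iter (β a) a _ _ _ h
  have := key (List.finRange n)
  rwa [← Fin.sum_univ_def] at this

/-- Every variable of the polynomial is of order below `r`, so its top symbol vanishes, and sums and
products preserve this. Hence `T_{2k+1}` does not affect ellipticity. -/
theorem polyTensor (hU : IsOpen U) (hg : IsLocalMetric U g) {d : ℕ} (hr : d < r)
    (Q : Fin n → Fin n → MvPolynomial (JetVar n d) ℝ) (i j : Fin n) :
    HasSymbol U g (fun g' y => TensorFlow.polyTensor Q g' y i j) r fun _ _ _ => 0 := by
  obtain ⟨r, rfl⟩ : ∃ q, r = q + 1 := ⟨r - 1, by omega⟩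
  simp only [TensorFlow.polyTensor, Matrix.of_apply]
  induction Q i j using MvPolynomial.induction_on with
  | C a => simpa using const contDiffOn_const hU
  | add p q hp hq =>
    simp only [map_add]
    exact (hp.add hq).congr_symbol fun _ _ _ _ => by simp
  | mul_X p v hp =>
    simp only [map_mul, MvPolynomial.eval_X]
    refine hp.mul_zero ?_
    rcases v with ⟨⟨β, hβ⟩, a, b⟩ | ⟨a, b⟩
    · obtain ⟨τ, h⟩ := multiPd hU hg.1 a b β
      exact h.of_lt (by omega)
    · exact inv hU hg a b

end HasSymbol

end Lin

/-! ### Symbols of curvature, of the gauge field and of the adjusted operator. -/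

section Symbols

variable {n : ℕ}

/-- The symbol of the linearized Christoffel symbols, for the inverse metric `G`. -/
def christoffelSymbol (G : Matrix (Fin n) (Fin n) ℝ) (ξ : Fin n → ℝ)
    (η : Matrix (Fin n) (Fin n) ℝ) (k i j : Fin n) : ℝ :=
  (1 / 2) * ∑ l, G k l * (ξ i * η j l + ξ j * η i l - ξ l * η i j)

/-- The symbol of the linearized Ricci curvature, for the inverse metric `G`. -/
def ricciSymbol (G : Matrix (Fin n) (Fin n) ℝ) (ξ : Fin n → ℝ)
    (η : Matrix (Fin n) (Fin n) ℝ) (i j : Fin n) : ℝ :=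
  ∑ k, (ξ k * christoffelSymbol G ξ η k i j - ξ j * christoffelSymbol G ξ η k i k)

/-- The symbol of the linearized scalar curvature, for the inverse metric `G`. -/
def scalarSymbol (G : Matrix (Fin n) (Fin n) ℝ) (ξ : Fin n → ℝ)
    (η : Matrix (Fin n) (Fin n) ℝ) : ℝ :=
  ∑ i, ∑ j, G i j * ricciSymbol G ξ η i j

/-- The symbol of the linearization of `V`, for the inverse metric `G`. -/
def vecVSymbol (G : Matrix (Fin n) (Fin n) ℝ) (ξ : Fin n → ℝ)
    (η : Matrix (Fin n) (Fin n) ℝ) (γ : Fin n) : ℝ :=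
  ∑ i, ∑ j, G i j * christoffelSymbol G ξ η γ i j

/-- The symbol of the linearization of `Z`, for the inverse metric `G`. -/
def vecZSymbol (G : Matrix (Fin n) (Fin n) ℝ) (ξ : Fin n → ℝ)
    (η : Matrix (Fin n) (Fin n) ℝ) (γ : Fin n) : ℝ :=
  ∑ μ, ∑ ν, ∑ i, ∑ j, G μ i * G ν j * (ξ μ * (ξ ν * christoffelSymbol G ξ η γ i j))

/-- The quadratic form `G^{ij} ξ_i ξ_j`. -/
def quadForm (G : Matrix (Fin n) (Fin n) ℝ) (ξ : Fin n → ℝ) : ℝ :=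
  ∑ i, ∑ j, G i j * ξ i * ξ j

/-- The symbol of the linearization of `W`, for the inverse metric `G`. -/
def adjustFieldSymbol (k : ℕ) (c α β : ℝ) (G : Matrix (Fin n) (Fin n) ℝ) (ξ : Fin n → ℝ)
    (η : Matrix (Fin n) (Fin n) ℝ) (γ : Fin n) : ℝ :=
  (-1) ^ k * c * (α * (quadForm G ξ ^ k * vecVSymbol G ξ η γ) +
    β * (quadForm G ξ ^ (k - 1) * vecZSymbol G ξ η γ))

/-- The symbol of the linearization of `L`, for the metric `g` with inverse `G`. -/
def adjustedOpSymbol (k : ℕ) (a b c α β : ℝ) (g G : Matrix (Fin n) (Fin n) ℝ) (ξ : Fin n → ℝ)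
    (η : Matrix (Fin n) (Fin n) ℝ) (i j : Fin n) : ℝ :=
  (-1) ^ (k + 1) * c * (quadForm G ξ ^ k * ricciSymbol G ξ η i j
    + a * (g i j * (quadForm G ξ ^ k * scalarSymbol G ξ η))
    - b * (quadForm G ξ ^ (k - 1) * (ξ j * (ξ i * scalarSymbol G ξ η)))) +
  ∑ l, (g l j * (ξ i * adjustFieldSymbol k c α β G ξ η l) +
    g i l * (ξ j * adjustFieldSymbol k c α β G ξ η l))

variable {U : Set (Model n)} {g : MatrixField n}

namespace HasSymbol

theorem christoffel (hU : IsOpen U) (hg : IsLocalMetric U g) (k i j : Fin n) :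
    HasSymbol U g (fun g' => TensorFlow.christoffel g' k i j) 1
      (fun y ξ η => christoffelSymbol (g y)⁻¹ ξ η k i j) :=
  (sum hU Finset.univ fun l => (inv (r := 0) hU hg k l).mul_left_zero
    ((((entry hU hg.1 j l).pd hU i).add ((entry hU hg.1 i l).pd hU j)).sub hU
      ((entry hU hg.1 i j).pd hU l))).const_mul hU (1 / 2)

theorem christoffel_const (hU : IsOpen U) {h : MatrixField n} (hh : IsLocalMetric U h)
    (k i j : Fin n) :
    HasSymbol U g (fun _ => TensorFlow.christoffel h k i j) 1 (fun _ _ _ => 0) :=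
  const (christoffel hU hh k i j).contDiffOn hU

theorem ricci (hU : IsOpen U) (hg : IsLocalMetric U g) (i j : Fin n) :
    HasSymbol U g (fun g' y => TensorFlow.ricci g' y i j) 2
      (fun y ξ η => ricciSymbol (g y)⁻¹ ξ η i j) := by
  have h1 : ∀ k i j, HasSymbol U g (fun g' => TensorFlow.christoffel g' k i j) 2
      fun _ _ _ => 0 := fun k i j => (christoffel hU hg k i j).of_lt (by omega)
  refine ((sum hU Finset.univ fun k => ((christoffel hU hg k i j).pd hU k).sub hU
      ((christoffel hU hg k i k).pd hU j)).add
    (sum_zero hU Finset.univ fun k => sum_zero hU Finset.univ fun l =>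
      (((h1 k k l).mul_zero (h1 l i j)).sub hU
        ((h1 k j l).mul_zero (h1 l i k))).congr_symbol
        (τ' := fun _ _ _ => 0) fun _ _ _ _ => by simp)).congr_symbol ?_
  intro y _ ξ η
  simp [ricciSymbol]

theorem scalarCurv (hU : IsOpen U) (hg : IsLocalMetric U g) :
    HasSymbol U g TensorFlow.scalarCurv 2 (fun y ξ η => scalarSymbol (g y)⁻¹ ξ η) :=
  sum hU Finset.univ fun i => sum hU Finset.univ fun j =>
    (inv (r := 1) hU hg i j).mul_left_zero (ricci hU hg i j)

/-- The connection terms contain at most `max 1 r < r + 1` derivatives of the metric, so only the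
coordinate derivative counts. The map `H` covers both uses: `H g' = g'` for the Levi-Civita
connection and constant `H` for the fixed background metric. -/
theorem mixedCov (hU : IsOpen U) (hg : IsLocalMetric U g) {H : MatrixField n → MatrixField n}
    (hH : ∀ k i j, ∃ τ, HasSymbol U g (fun g' => TensorFlow.christoffel (H g') k i j) 1 τ)
    {p q r : ℕ} (hr : 1 ≤ r) {F : MatrixField n → TensorField n p q}
    {τ : (Fin p → Fin n) → (Fin q → Fin n) →
      Model n → (Fin n → ℝ) → Matrix (Fin n) (Fin n) ℝ → ℝ}
    (hF : ∀ I J, HasSymbol U g (fun g' => F g' I J) r (τ I J)) (I : Fin (p + 1) → Fin n)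
    (J : Fin q → Fin n) :
    HasSymbol U g (fun g' => TensorFlow.mixedCov g' (H g') (F g') I J) (r + 1)
      (fun y ξ η => ξ (I (Fin.last p)) * τ (fun l => I l.castSucc) J y ξ η) := by
  have hΓ : ∀ k i j, HasSymbol U g (fun g' => TensorFlow.christoffel g' k i j) (r + 1)
      fun _ _ _ => 0 := fun k i j => (christoffel hU hg k i j).of_lt (by omega)
  have hΓ' : ∀ k i j, HasSymbol U g (fun g' => TensorFlow.christoffel (H g') k i j) (r + 1)
      fun _ _ _ => 0 := fun k i j => (hH k i j).choose_spec.of_lt (by omega)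
  have hF' : ∀ I J, HasSymbol U g (fun g' => F g' I J) (r + 1) fun _ _ _ => 0 :=
    fun I J => (hF I J).of_lt (by omega)
  refine ((((hF _ J).pd hU (I (Fin.last p))).sub hU
    (sum_zero hU Finset.univ fun l => sum_zero hU Finset.univ fun c =>
      (hF' (Function.update (fun l => I l.castSucc) l c) J).mul_zero
        (hΓ c (I (Fin.last p)) (I l.castSucc)))).add
    (sum_zero hU Finset.univ fun l => sum_zero hU Finset.univ fun c =>
      (hF' (fun l => I l.castSucc) (Function.update J l c)).mul_zero
        (hΓ' (J l) c (I (Fin.last p))))).congr_symbol ?_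
  intro y _ ξ η
  simp

theorem mixedLap (hU : IsOpen U) (hg : IsLocalMetric U g) {H : MatrixField n → MatrixField n}
    (hH : ∀ k i j, ∃ τ, HasSymbol U g (fun g' => TensorFlow.christoffel (H g') k i j) 1 τ)
    {p q r : ℕ} (hr : 1 ≤ r) {F : MatrixField n → TensorField n p q}
    {τ : (Fin p → Fin n) → (Fin q → Fin n) →
      Model n → (Fin n → ℝ) → Matrix (Fin n) (Fin n) ℝ → ℝ}
    (hF : ∀ I J, HasSymbol U g (fun g' => F g' I J) r (τ I J)) (I : Fin p → Fin n)
    (J : Fin q → Fin n) :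
    HasSymbol U g (fun g' => TensorFlow.mixedLap g' (H g') (F g') I J) (r + 2)
      (fun y ξ η => quadForm (g y)⁻¹ ξ * τ I J y ξ η) := by
  have h2 := mixedCov hU hg hH (by omega) (mixedCov hU hg hH hr hF)
  refine (sum hU Finset.univ fun μ => sum hU Finset.univ fun ν =>
    (inv (r := r + 1) hU hg μ ν).mul_left_zero (h2 (Fin.snoc (α := fun _ => Fin n)
      (Fin.snoc (α := fun _ => Fin n) I ν) μ) J)).congr_symbol ?_
  intro y _ ξ η
  simp only [Fin.snoc_last, Fin.snoc_castSucc, quadForm, Finset.sum_mul]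
  exact Finset.sum_congr rfl fun _ _ => Finset.sum_congr rfl fun _ _ => by ring

theorem mixedLap_iterate (hU : IsOpen U) (hg : IsLocalMetric U g)
    {H : MatrixField n → MatrixField n}
    (hH : ∀ k i j, ∃ τ, HasSymbol U g (fun g' => TensorFlow.christoffel (H g') k i j) 1 τ)
    {p q r : ℕ} (hr : 1 ≤ r) {F : MatrixField n → TensorField n p q}
    {τ : (Fin p → Fin n) → (Fin q → Fin n) →
      Model n → (Fin n → ℝ) → Matrix (Fin n) (Fin n) ℝ → ℝ}
    (hF : ∀ I J, HasSymbol U g (fun g' => F g' I J) r (τ I J)) (m : ℕ) (I : Fin p → Fin n)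
    (J : Fin q → Fin n) :
    HasSymbol U g (fun g' => (TensorFlow.mixedLap g' (H g'))^[m] (F g') I J) (r + 2 * m)
      (fun y ξ η => quadForm (g y)⁻¹ ξ ^ m * τ I J y ξ η) := by
  induction m generalizing I J with
  | zero => simpa using hF I J
  | succ m ih =>
    simp only [Function.iterate_succ_apply']
    exact (mixedLap hU hg hH (by omega) ih I J).congr_symbol fun y _ ξ η => by ring

theorem christoffel_exists (hU : IsOpen U) (hg : IsLocalMetric U g) (k i j : Fin n) :
    ∃ τ, HasSymbol U g (fun g' => TensorFlow.christoffel g' k i j) 1 τ :=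
  ⟨_, christoffel hU hg k i j⟩

theorem flowTensor (hU : IsOpen U) (hg : IsLocalMetric U g) {k : ℕ} (hk : 1 ≤ k) (a b c : ℝ)
    (T₀ : PolyNaturalTensor n (2 * k + 1)) (i j : Fin n) :
    HasSymbol U g (fun g' y => TensorFlow.flowTensor k a b c T₀ g' y i j) (2 * (k + 1))
      (fun y ξ η => (-1) ^ (k + 1) * c * (quadForm (g y)⁻¹ ξ ^ k * ricciSymbol (g y)⁻¹ ξ η i j
        + a * (g y i j * (quadForm (g y)⁻¹ ξ ^ k * scalarSymbol (g y)⁻¹ ξ η))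
        - b * (quadForm (g y)⁻¹ ξ ^ (k - 1) * (ξ j * (ξ i * scalarSymbol (g y)⁻¹ ξ η))))) := by
  have hH := christoffel_exists hU hg
  have h1 := mixedLap_iterate hU hg hH (r := 2) (by omega)
    (F := fun g' => (TensorFlow.ricci g').toTensor)
    (fun I _ => ricci hU hg (I 0) (I 1)) k ![i, j] ![]
  have hS : ∀ (I : Fin 0 → Fin n) (J : Fin 0 → Fin n),
      HasSymbol U g (fun g' => scalarTensor (TensorFlow.scalarCurv g') I J) 2
        (fun y ξ η => scalarSymbol (g y)⁻¹ ξ η) := fun _ _ => scalarCurv hU hg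
  have h2 := mixedLap_iterate hU hg hH (by omega) hS k ![] ![]
  have h3 := mixedLap_iterate hU hg hH (by omega)
    (mixedCov hU hg hH (by omega) (mixedCov hU hg hH (by omega) hS)) (k - 1) ![i, j] ![]
  rw [show 2 + 2 * k = 2 * (k + 1) by ring] at h1 h2
  -- The two derivatives of the Hessian replace one Laplacian; with truncated subtraction this count
  -- needs `1 ≤ k`.
  rw [show 2 + 1 + 1 + 2 * (k - 1) = 2 * (k + 1) by omega] at h3
  have hgij := (entry hU hg.1 i j).of_lt (show 0 < 2 * (k + 1) by omega)
  have h2' := ((hgij.mul_left_zero h2).const_mul hU a)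
  refine ((((h1.add h2').sub hU (h3.const_mul hU b)).const_mul hU ((-1) ^ (k + 1) * c)).add
    (polyTensor hU hg (by omega) T₀.poly i j)).congr_symbol ?_ |>.congr_fun ?_
  · intro y _ ξ η
    simp
  · intro g'
    funext y
    simp only [TensorFlow.flowTensor, Matrix.of_apply, mul_comm]

theorem adjustField (hU : IsOpen U) (hg : IsLocalMetric U g) {h : MatrixField n}
    (hh : IsLocalMetric U h) {k : ℕ} (hk : 1 ≤ k) (c α β : ℝ) (I : Fin 0 → Fin n)
    (J : Fin 1 → Fin n) :
    HasSymbol U g (fun g' => TensorFlow.adjustField k c α β g' h I J) (2 * k + 1)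
      (fun y ξ η => adjustFieldSymbol k c α β (g y)⁻¹ ξ η (J 0)) := by
  have hH : ∀ k i j, ∃ τ, HasSymbol U g (fun _ => TensorFlow.christoffel h k i j) 1 τ :=
    fun k i j => ⟨_, christoffel_const hU hh k i j⟩
  have hA : ∀ I J, HasSymbol U g (fun g' => diffTensor g' h I J) 1
      (fun y ξ η => christoffelSymbol (g y)⁻¹ ξ η (J 0) (I 0) (I 1)) := fun I J =>
    ((christoffel hU hg _ _ _).sub hU (christoffel_const hU hh _ _ _)).congr_symbol
      fun _ _ _ _ => by simp
  have hV : ∀ I J, HasSymbol U g (fun g' => vecV g' h I J) 1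
      (fun y ξ η => vecVSymbol (g y)⁻¹ ξ η (J 0)) := fun I J =>
    sum hU Finset.univ fun a => sum hU Finset.univ fun b =>
      (inv (r := 0) hU hg a b).mul_left_zero (hA ![a, b] J)
  have hZ : ∀ I J, HasSymbol U g (fun g' => vecZ g' h I J) 3
      (fun y ξ η => vecZSymbol (g y)⁻¹ ξ η (J 0)) := fun I J =>
    sum hU Finset.univ fun μ => sum hU Finset.univ fun ν => sum hU Finset.univ fun a =>
      sum hU Finset.univ fun b =>
      ((inv (r := 2) hU hg μ a).mul_zero (inv (r := 2) hU hg ν b)).mul_left_zero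
        (mixedCov hU hg hH (by omega) (mixedCov hU hg hH (by omega) hA) ![a, b, ν, μ] J)
  have h1 := mixedLap_iterate hU hg hH (by omega) hV k I J
  have h2 := mixedLap_iterate hU hg hH (by omega) hZ (k - 1) I J
  rw [show 1 + 2 * k = 2 * k + 1 by ring] at h1
  rw [show 3 + 2 * (k - 1) = 2 * k + 1 by omega] at h2
  exact ((h1.const_mul hU α).add (h2.const_mul hU β)).const_mul hU ((-1) ^ k * c)

/-- In the Lie derivative, `W` has order `2k + 1`, so only the terms that differentiate `W` reach
order `2k + 2`. -/
theorem adjustedOp (hU : IsOpen U) (hg : IsLocalMetric U g) {h : MatrixField n}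
    (hh : IsLocalMetric U h) {k : ℕ} (hk : 1 ≤ k) (a b c α β : ℝ)
    (T₀ : PolyNaturalTensor n (2 * k + 1)) (i j : Fin n) :
    HasSymbol U g (fun g' y => TensorFlow.adjustedOp k a b c α β T₀ g' h y i j) (2 * (k + 1))
      (fun y ξ η => adjustedOpSymbol k a b c α β (g y) (g y)⁻¹ ξ η i j) := by
  have hW := fun l => adjustField hU hg hh hk c α β ![] ![l]
  have hE := fun i j => (entry hU hg.1 i j).of_lt (show 0 < 2 * k + 1 + 1 by omega)
  refine ((flowTensor hU hg hk a b c T₀ i j).add (sum hU Finset.univ fun l =>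
    ((((hW l).of_lt (Nat.lt_succ_self _)).mul_zero
      (((entry hU hg.1 i j).pd hU l).of_lt (show 0 + 1 < 2 * k + 1 + 1 by omega))).add
      ((hE l j).mul_left_zero ((hW l).pd hU i))).add
      ((hE i l).mul_left_zero ((hW l).pd hU j)))).congr_symbol ?_
  intro y _ ξ η
  simp [adjustedOpSymbol]

end HasSymbol

end Symbols

/-! ### Symmetry of the operator's values, and stability of metrics under perturbation. -/

section Symmetry

variable {n : ℕ} {U : Set (Model n)} {g h : MatrixField n}

theorem inv_symm_of_isLocalMetric (hg : IsLocalMetric U g) {y : Model n} (hy : y ∈ U)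
    (i j : Fin n) : (g y)⁻¹ i j = (g y)⁻¹ j i :=
  ((hg.1.2 y hy).inv.apply j i)

theorem christoffel_symm (hU : IsOpen U) (hg : IsLocalMetric U g) {y : Model n} (hy : y ∈ U)
    (k i j : Fin n) : christoffel g k i j y = christoffel g k j i y := by
  unfold christoffel
  congr 1
  refine Finset.sum_congr rfl fun l _ => ?_
  rw [pd_congr hU (f := fun z => g z i j) (f' := fun z => g z j i)
    (fun z hz => (hg.1.2 z hz).apply j i) l hy]
  ring

/-- The other two derivative terms cancel on contraction with the symmetric `g^{kl}`. -/
theorem christoffel_trace (hg : IsLocalMetric U g) {y : Model n} (hy : y ∈ U)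
    (i : Fin n) : ∑ k, christoffel g k i k y =
      (1 / 2) * ∑ k, ∑ l, (g y)⁻¹ k l * pd i (fun z => g z k l) y := by
  have hsw : ∑ k, ∑ l, (g y)⁻¹ k l * pd k (fun z => g z i l) y =
      ∑ k, ∑ l, (g y)⁻¹ k l * pd l (fun z => g z i k) y := by
    rw [Finset.sum_comm]
    exact Finset.sum_congr rfl fun k _ => Finset.sum_congr rfl fun l _ => by
      rw [inv_symm_of_isLocalMetric hg hy]
  simp only [christoffel, ← Finset.mul_sum, mul_sub, mul_add, Finset.sum_sub_distrib,
    Finset.sum_add_distrib, hsw]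
  ring

theorem contDiffOn_inv (hU : IsOpen U) (hg : IsLocalMetric U g) (i j : Fin n) :
    ContDiffOn ℝ ∞ (fun y => (g y)⁻¹ i j) U :=
  (HasSymbol.inv (r := 0) hU hg i j).contDiffOn

theorem pd_inv (hU : IsOpen U) (hg : IsLocalMetric U g) {y : Model n} (hy : y ∈ U)
    (m a b : Fin n) : pd m (fun z => (g z)⁻¹ a b) y =
      -∑ c, ∑ d, (g y)⁻¹ a c * (g y)⁻¹ d b * pd m (fun z => g z c d) y := by
  have hG : ∀ i j, DifferentiableAt ℝ (fun z => (g z)⁻¹ i j) y := fun i j =>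
    differentiableAt_of_contDiffOn hU (contDiffOn_inv hU hg i j) hy
  have hgd : ∀ i j, DifferentiableAt ℝ (fun z => g z i j) y := fun i j =>
    differentiableAt_of_contDiffOn hU (hg.1.1 i j) hy
  have hu : ∀ z ∈ U, IsUnit (g z).det := fun z hz => isUnit_iff_ne_zero.2 (hg.2 z hz).det_pos.ne'
  set X : Matrix (Fin n) (Fin n) ℝ := Matrix.of fun i j => pd m (fun z => (g z)⁻¹ i j) y with hX
  set B : Matrix (Fin n) (Fin n) ℝ := Matrix.of fun i j => pd m (fun z => g z i j) y with hB
  have key : B * (g y)⁻¹ + g y * X = 0 := by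
    ext i k
    have h1 : Set.EqOn (fun z => ∑ j, g z i j * (g z)⁻¹ j k)
        (fun _ => (1 : Matrix (Fin n) (Fin n) ℝ) i k) U := by
      intro z hz
      beta_reduce
      rw [← Matrix.mul_apply, Matrix.mul_nonsing_inv _ (hu z hz)]
    have h2 := pd_congr hU h1 m hy
    rw [pd_sum _ fun j _ => (hgd i j).fun_mul (hG j k), pd_const] at h2
    rw [Finset.sum_congr rfl fun j _ => pd_mul (hgd i j) (hG j k) m] at h2
    simp only [Finset.sum_add_distrib] at h2
    simpa [Matrix.mul_apply, hX, hB] using h2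
  have : X = -((g y)⁻¹ * B * (g y)⁻¹) := by
    have := congrArg (fun Y => (g y)⁻¹ * Y) key
    simp only [mul_add, Matrix.mul_zero, ← mul_assoc, Matrix.nonsing_inv_mul _ (hu y hy),
      one_mul] at this
    exact eq_neg_of_add_eq_zero_right this
  have h3 := congrFun (congrFun this a) b
  rw [hX, Matrix.of_apply] at h3
  rw [h3]
  simp only [Matrix.neg_apply, Matrix.mul_apply, Finset.sum_mul, hB, Matrix.of_apply]
  rw [Finset.sum_comm]
  congr 1
  exact Finset.sum_congr rfl fun _ _ => Finset.sum_congr rfl fun _ _ => by ring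

/-- The trace `Γ^k_{ik}` is the gradient of `½ log det g`, so its derivative is symmetric. The proof
expands instead: `g^{kl} ∂_j ∂_i g_{kl}` is symmetric, and so is the quadratic term coming from `∂
g⁻¹`. This is the only part of Ricci whose symmetry is not immediate. -/
theorem pd_christoffel_trace (hU : IsOpen U) (hg : IsLocalMetric U g) {y : Model n} (hy : y ∈ U)
    (i j : Fin n) : ∑ k, pd j (christoffel g k i k) y = ∑ k, pd i (christoffel g k j k) y := by
  have hG : ∀ i j, DifferentiableAt ℝ (fun z => (g z)⁻¹ i j) y := fun i j =>
    differentiableAt_of_contDiffOn hU (contDiffOn_inv hU hg i j) hy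
  have hpg : ∀ m i j, DifferentiableAt ℝ (pd m fun z => g z i j) y := fun m i j =>
    differentiableAt_of_contDiffOn hU (contDiffOn_pd hU (hg.1.1 i j) m) hy
  have key : ∀ i j, ∑ k, pd j (christoffel g k i k) y =
      (1 / 2) * (∑ k, ∑ l, (g y)⁻¹ k l * pd j (pd i fun z => g z k l) y -
        ∑ k, ∑ l, ∑ c, ∑ d, (g y)⁻¹ k c * (g y)⁻¹ d l * pd j (fun z => g z c d) y *
          pd i (fun z => g z k l) y) := by
    intro i j
    rw [← pd_sum _ fun k _ => differentiableAt_of_contDiffOn hU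
      (HasSymbol.christoffel hU hg k i k).contDiffOn hy]
    rw [pd_congr hU (fun z hz => christoffel_trace hg hz i) j hy]
    have hd : ∀ k l, DifferentiableAt ℝ
        (fun z => (g z)⁻¹ k l * pd i (fun z => g z k l) z) y := fun k l =>
      (hG k l).fun_mul (hpg i k l)
    rw [pd_const_mul (DifferentiableAt.fun_sum fun k _ =>
      DifferentiableAt.fun_sum fun l _ => hd k l),
      pd_sum _ fun k _ => DifferentiableAt.fun_sum fun l _ => hd k l, ← Finset.sum_sub_distrib]
    congr 1
    refine Finset.sum_congr rfl fun k _ => ?_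
    rw [pd_sum _ fun l _ => hd k l, ← Finset.sum_sub_distrib]
    refine Finset.sum_congr rfl fun l _ => ?_
    rw [pd_mul (hG k l) (hpg i k l), pd_inv hU hg hy, neg_mul, add_comm, sub_eq_add_neg]
    simp only [Finset.sum_mul]
  rw [key, key]
  congr 2
  · refine Finset.sum_congr rfl fun k _ => Finset.sum_congr rfl fun l _ => ?_
    rw [pd_comm hU (hg.1.1 k l) j i hy]
  · have hsplit : ∀ i j, ∑ k, ∑ l, ∑ c, ∑ d, (g y)⁻¹ k c * (g y)⁻¹ d l *
        pd j (fun z => g z c d) y * pd i (fun z => g z k l) y =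
        ∑ p : Fin n × Fin n, ∑ q : Fin n × Fin n, (g y)⁻¹ p.1 q.1 * (g y)⁻¹ q.2 p.2 *
          pd j (fun z => g z q.1 q.2) y * pd i (fun z => g z p.1 p.2) y := by
      intro i j
      simp only [Fintype.sum_prod_type]
    -- Exchanging the index pairs `(k, l)` and `(c, d)` exchanges the roles of `i` and `j`.
    rw [hsplit, hsplit, Finset.sum_comm]
    refine Finset.sum_congr rfl fun p _ => Finset.sum_congr rfl fun q _ => ?_
    rw [inv_symm_of_isLocalMetric hg hy q.1, inv_symm_of_isLocalMetric hg hy p.2]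
    ring

theorem ricci_symm (hU : IsOpen U) (hg : IsLocalMetric U g) {y : Model n} (hy : y ∈ U)
    (i j : Fin n) : ricci g y i j = ricci g y j i := by
  simp only [ricci, Matrix.of_apply, Finset.sum_sub_distrib]
  rw [pd_christoffel_trace hU hg hy i j]
  have h1 : ∀ k, pd k (christoffel g k i j) y = pd k (christoffel g k j i) y := fun k =>
    pd_congr hU (fun z hz => christoffel_symm hU hg hz k i j) k hy
  simp only [h1, christoffel_symm hU hg hy _ i j]
  congr 2
  rw [Finset.sum_comm]
  exact Finset.sum_congr rfl fun k _ => Finset.sum_congr rfl fun l _ => by ring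

/-- The field `F` is invariant on `U` under a permutation of its lower indices. -/
def LowerInvariant {p q : ℕ} (U : Set (Model n)) (σ : Equiv.Perm (Fin p)) (F : TensorField n p q) :
    Prop :=
  ∀ I J, Set.EqOn (F (I ∘ σ) J) (F I J) U

/-- The derivative index is appended last, so a symmetry of the old indices survives when extended
by fixing the last one. Hence the Laplacian preserves symmetry in the first two slots. -/
theorem LowerInvariant.mixedCov {p q : ℕ} (hU : IsOpen U) {σ : Equiv.Perm (Fin p)}
    {σ' : Equiv.Perm (Fin (p + 1))} (hσ : ∀ l : Fin p, σ' l.castSucc = (σ l).castSucc)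
    (hσ' : σ' (Fin.last p) = Fin.last p) {F : TensorField n p q} (hF : LowerInvariant U σ F)
    (g h : MatrixField n) : LowerInvariant U σ' (mixedCov g h F) := by
  intro I J y hy
  have hI : (fun l : Fin p => (I ∘ σ') l.castSucc) = (fun l => I l.castSucc) ∘ σ := by
    funext l; simp [hσ]
  simp only [TensorFlow.mixedCov]
  rw [hI]
  simp only [Function.comp_apply, hσ']
  rw [pd_congr hU (hF _ J) _ hy]
  congr 1
  · congr 1
    refine Eq.trans ?_ (Equiv.sum_comp σ _)
    refine Finset.sum_congr rfl fun l _ => Finset.sum_congr rfl fun c _ => ?_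
    rw [← hF (Function.update (fun l => I l.castSucc) (σ l) c) J hy, hσ,
      Function.update_comp_equiv, Equiv.symm_apply_apply]
  · exact Finset.sum_congr rfl fun l _ => Finset.sum_congr rfl fun c _ => by rw [hF _ _ hy]

theorem LowerInvariant.mixedLap {q : ℕ} (hU : IsOpen U) {F : TensorField n 2 q}
    (hF : LowerInvariant U (Equiv.swap 0 1) F) (g h : MatrixField n) :
    LowerInvariant U (Equiv.swap 0 1) (mixedLap g h F) := by
  intro I J y hy
  have h1 : LowerInvariant U (Equiv.swap (0 : Fin 3) 1) (TensorFlow.mixedCov g h F) :=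
    hF.mixedCov hU (by decide) (by decide) g h
  have h2 : LowerInvariant U (Equiv.swap (0 : Fin 4) 1)
      (TensorFlow.mixedCov g h (TensorFlow.mixedCov g h F)) :=
    h1.mixedCov hU (by decide) (by decide) g h
  refine Finset.sum_congr rfl fun μ _ => Finset.sum_congr rfl fun ν _ => ?_
  congr 1
  rw [← h2 _ J hy]
  congr 1
  funext l
  fin_cases l <;> rfl

theorem LowerInvariant.mixedLap_iterate {q : ℕ} (hU : IsOpen U) {F : TensorField n 2 q}
    (hF : LowerInvariant U (Equiv.swap 0 1) F) (g h : MatrixField n) (m : ℕ) :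
    LowerInvariant U (Equiv.swap 0 1) ((TensorFlow.mixedLap g h)^[m] F) := by
  induction m with
  | zero => exact hF
  | succ m ih => rw [Function.iterate_succ_apply']; exact ih.mixedLap hU g h

theorem LowerInvariant.apply_swap {F : TensorField n 2 0}
    (hF : LowerInvariant U (Equiv.swap 0 1) F) {y : Model n} (hy : y ∈ U) (i j : Fin n) :
    F ![j, i] ![] y = F ![i, j] ![] y := by
  rw [← hF ![i, j] ![] hy]
  congr 1
  funext l
  fin_cases l <;> rfl

theorem lowerInvariant_toTensor {u : MatrixField n} (hu : ∀ y ∈ U, (u y).IsSymm) :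
    LowerInvariant U (Equiv.swap 0 1) u.toTensor := by
  intro I J y hy
  exact (hu y hy).apply _ _

/-- Second coordinate derivatives commute and the connection has no torsion. -/
theorem lowerInvariant_hessian (hU : IsOpen U) (hg : IsLocalMetric U g) {f : Model n → ℝ}
    (hf : ContDiffOn ℝ ∞ f U) :
    LowerInvariant U (Equiv.swap 0 1) (mixedCov g g (mixedCov g g (scalarTensor f))) := by
  have h1 : ∀ I J, mixedCov g g (scalarTensor f) I J = pd (I 0) f := by
    intro I J
    funext y
    simp [mixedCov, scalarTensor]
  have h2 : ∀ (I : Fin 2 → Fin n) (J) (y), mixedCov g g (mixedCov g g (scalarTensor f)) I J y =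
      pd (I 1) (pd (I 0) f) y - ∑ c, pd c f y * christoffel g c (I 1) (I 0) y := by
    intro I J y
    rw [mixedCov]
    simp only [h1]
    simp
  intro I J y hy
  rw [h2, h2]
  simp only [Function.comp_apply, Equiv.swap_apply_left, Equiv.swap_apply_right]
  rw [pd_comm hU hf _ _ hy]
  simp only [christoffel_symm hU hg hy _ (I 0) (I 1)]

theorem flowTensor_symm (hU : IsOpen U) (hg : IsLocalMetric U g) (k : ℕ) (a b c : ℝ)
    (T₀ : PolyNaturalTensor n (2 * k + 1)) {y : Model n} (hy : y ∈ U) :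
    (flowTensor k a b c T₀ g y).IsSymm := by
  refine Matrix.IsSymm.ext fun i j => ?_
  simp only [flowTensor, Matrix.of_apply]
  rw [((lowerInvariant_toTensor fun y hy => Matrix.IsSymm.ext fun i j =>
      ricci_symm hU hg hy j i).mixedLap_iterate hU g g k).apply_swap hy,
    ((lowerInvariant_hessian hU hg
      (HasSymbol.scalarCurv hU hg).contDiffOn).mixedLap_iterate hU g g (k - 1)).apply_swap hy,
    (hg.1.2 y hy).apply i j, (T₀.symm U g hU hg y hy).apply i j]

theorem lieMetric_symm (hU : IsOpen U) (hg : IsSmoothSymm U g) (W : TensorField n 0 1)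
    {y : Model n} (hy : y ∈ U) : (lieMetric W g y).IsSymm := by
  refine Matrix.IsSymm.ext fun i j => ?_
  simp only [lieMetric, Matrix.of_apply]
  refine Finset.sum_congr rfl fun k _ => ?_
  rw [pd_congr hU (f := fun z => g z j i) (f' := fun z => g z i j)
    (fun z hz => (hg.2 z hz).apply i j) k hy, (hg.2 y hy).apply j k, (hg.2 y hy).apply i k]
  ring

theorem adjustedOp_symm (hU : IsOpen U) (hg : IsLocalMetric U g) (h : MatrixField n) (k : ℕ)
    (a b c α β : ℝ) (T₀ : PolyNaturalTensor n (2 * k + 1)) {y : Model n} (hy : y ∈ U) :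
    (adjustedOp k a b c α β T₀ g h y).IsSymm :=
  (flowTensor_symm hU hg k a b c T₀ hy).add (lieMetric_symm hU hg.1 _ hy)

/-- Positive definiteness persists along a continuous family of symmetric matrices. -/
theorem eventually_posDef {X : Type*} [TopologicalSpace X] {A : X → Matrix (Fin n) (Fin n) ℝ}
    {x₀ : X} (hA : ∀ i j, ContinuousAt (fun x => A x i j) x₀)
    (hs : ∀ᶠ x in nhds x₀, (A x).IsSymm) (hpos : (A x₀).PosDef) :
    ∀ᶠ x in nhds x₀, (A x).PosDef := by
  -- Positivity at `x₀` spreads to a neighbourhood uniformly over the compact unit sphere, and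
  -- homogeneity then extends it to all nonzero vectors.
  have hsph : IsCompact (Metric.sphere (0 : Fin n → ℝ) 1) := isCompact_sphere _ _
  have h1 : ∀ᶠ x in nhds x₀, ∀ v ∈ Metric.sphere (0 : Fin n → ℝ) 1,
      0 < ∑ i, ∑ j, v i * (A x i j * v j) := by
    refine hsph.eventually_forall_of_forall_eventually fun v hv => ?_
    have hc : ContinuousAt (fun p : X × (Fin n → ℝ) => ∑ i, ∑ j, p.2 i * (A p.1 i j * p.2 j))
        (x₀, v) := by
      refine tendsto_finsetSum _ fun i _ => tendsto_finsetSum _ fun j _ => ?_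
      have e1 : ∀ l, ContinuousAt (fun p : X × (Fin n → ℝ) => p.2 l) (x₀, v) := fun l =>
        ((continuous_apply l).comp continuous_snd).continuousAt
      have e2 : ContinuousAt (fun p : X × (Fin n → ℝ) => A p.1 i j) (x₀, v) :=
        ContinuousAt.comp (f := Prod.fst) (g := fun x => A x i j) (hA i j) continuousAt_fst
      exact (e1 i).mul (e2.mul (e1 j))
    refine hc.eventually (lt_mem_nhds ?_)
    have hv0 : v ≠ 0 := by rintro rfl; simp at hv
    have := hpos.dotProduct_mulVec_pos hv0
    simpa [dotProduct, Matrix.mulVec, Finset.mul_sum] using this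
  filter_upwards [h1, hs] with x hx hsx
  refine Matrix.PosDef.of_dotProduct_mulVec_pos (by
    rw [Matrix.IsHermitian, Matrix.conjTranspose_eq_transpose_of_trivial]; exact hsx) fun v hv => ?_
  have hnv : 0 < ‖v‖ := norm_pos_iff.2 hv
  have := hx (‖v‖⁻¹ • v) (by simp [norm_smul, hnv.ne'])
  have h2 : ∑ i, ∑ j, (‖v‖⁻¹ • v) i * (A x i j * (‖v‖⁻¹ • v) j) =
      ‖v‖⁻¹ ^ 2 * ∑ i, ∑ j, v i * (A x i j * v j) := by
    simp only [Finset.mul_sum, Pi.smul_apply, smul_eq_mul]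
    exact Finset.sum_congr rfl fun _ _ => Finset.sum_congr rfl fun _ _ => by ring
  rw [h2] at this
  have h3 := (pos_iff_pos_of_mul_pos this).1 (by positivity)
  simpa [dotProduct, Matrix.mulVec, Finset.mul_sum] using h3

/-- For small `s`, the perturbation `g + s u` is a metric near any given point. -/
theorem eventually_isLocalMetric (hU : IsOpen U) (hg : IsLocalMetric U g) {u : MatrixField n}
    (hu : IsSmoothSymm U u) {y : Model n} (hy : y ∈ U) :
    ∀ᶠ s : ℝ in nhds 0, ∃ V : Set (Model n), IsOpen V ∧ y ∈ V ∧ IsLocalMetric V (g + s • u) := by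
  have hsymm : ∀ (s : ℝ), ∀ z ∈ U, ((g + s • u) z).IsSymm := fun s z hz =>
    (hg.1.2 z hz).add ((hu.2 z hz).smul s)
  have h1 : ∀ᶠ p : ℝ × Model n in nhds (0, y), ((g + p.1 • u) p.2).PosDef := by
    refine eventually_posDef (A := fun p : ℝ × Model n => (g + p.1 • u) p.2) (fun i j => ?_) ?_ ?_
    · obtain ⟨P, -, h⟩ := HasSymbol.entry hU hg.1 i j
      exact (h u hu y hy).1.continuousAt
    · filter_upwards [continuousAt_snd.eventually (hU.mem_nhds hy)] with p hp using hsymm p.1 _ hp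
    · simpa using hg.2 y hy
  rw [nhds_prod_eq, Filter.eventually_prod_iff] at h1
  obtain ⟨p, hp, q, hq, h⟩ := h1
  obtain ⟨V, hV, hVo, hyV⟩ := eventually_nhds_iff.1 hq
  filter_upwards [hp] with s hs
  refine ⟨V ∩ U, hVo.inter hU, ⟨hyV, hy⟩, ⟨fun i j => ?_, fun z hz => hsymm s z hz.2⟩,
    fun z hz => h hs (hV z hz.1)⟩
  simp only [family_apply]
  exact ((hg.1.1 i j).add (contDiffOn_const.mul (hu.1 i j))).mono Set.inter_subset_right

end Symmetry

/-! ### Metrics on the manifold in coordinates. -/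

section Charts

variable {n : ℕ} {M : Type*} [TopologicalSpace M] [ChartedSpace (Model n) M]

theorem coordVector_injective {e : OpenPartialHomeomorph M (Model n)} (he : e ∈ charts n M)
    {y : Model n} (hy : y ∈ e.target) :
    Function.Injective (mfderiv 𝓘(ℝ, Model n) 𝓘(ℝ, Model n) e.symm y) := by
  have he1 : e ∈ IsManifold.maximalAtlas 𝓘(ℝ, Model n) 1 M :=
    IsManifold.maximalAtlas_subset_of_le ENat.LEInfty.out he
  have h1 := mdifferentiableAt_symm_of_mem_maximalAtlas he1 hy
  have h2 := mdifferentiableAt_of_mem_maximalAtlas he1 (e.map_target hy)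
  have h3 : (e ∘ e.symm) =ᶠ[nhds y] id := by
    filter_upwards [e.open_target.mem_nhds hy] with z hz using e.right_inv hz
  have h4 := mfderiv_comp (I := 𝓘(ℝ, Model n)) (I' := 𝓘(ℝ, Model n)) (I'' := 𝓘(ℝ, Model n))
    y h2 h1
  rw [h3.mfderiv_eq, mfderiv_id] at h4
  refine Function.LeftInverse.injective
    (g := mfderiv 𝓘(ℝ, Model n) 𝓘(ℝ, Model n) e (e.symm y)) fun v => ?_
  exact (DFunLike.congr_fun h4 v).symm

variable [IsManifold 𝓘(ℝ, Model n) ∞ M]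

/-- The tangent map of `e.symm` is smooth; compose it with the constant section `v`. -/
theorem contMDiffOn_coordVector {e : OpenPartialHomeomorph M (Model n)} (he : e ∈ charts n M)
    (v : Model n) : ContMDiffOn 𝓘(ℝ, Model n) (𝓘(ℝ, Model n).prod 𝓘(ℝ, Model n)) ∞
      (fun y => Bundle.TotalSpace.mk' (Model n) (E := TangentSpace 𝓘(ℝ, Model n)) (e.symm y)
        (mfderiv 𝓘(ℝ, Model n) 𝓘(ℝ, Model n) e.symm y v)) e.target := by
  have h1 := (contMDiffOn_symm_of_mem_maximalAtlas he).contMDiffOn_tangentMapWithin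
    (m := ∞) le_rfl e.open_target.uniqueMDiffOn
  have h2 : ContMDiff 𝓘(ℝ, Model n) (𝓘(ℝ, Model n).prod 𝓘(ℝ, Model n)) ∞
      (fun y => (⟨y, v⟩ : TangentBundle 𝓘(ℝ, Model n) (Model n))) :=
    contMDiff_vectorSpace_iff_contDiff.2 contDiff_const
  have h3 := h1.comp h2.contMDiffOn (s := e.target) fun y hy => hy
  refine h3.congr fun y hy => ?_
  simp only [Function.comp_apply, tangentMapWithin]
  rw [mfderivWithin_of_isOpen e.open_target hy]

theorem isLocalMetric_inChart (g : Metric n M) {e : OpenPartialHomeomorph M (Model n)}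
    (he : e ∈ charts n M) : IsLocalMetric e.target (g.inChart e) := by
  refine ⟨⟨fun i j => ?_, fun y hy => Matrix.IsSymm.ext fun i j => g.symm _ _ _⟩, fun y hy => ?_⟩
  · rw [← contMDiffOn_iff_contDiffOn]
    intro y hy
    have hg := (g.contMDiff.contMDiffAt (x := e.symm y)).comp_contMDiffWithinAt y
      (contMDiffOn_symm_of_mem_maximalAtlas he y hy)
    have := ContMDiffWithinAt.clm_bundle_apply₂ (F₁ := Model n) (F₂ := Model n) (F₃ := ℝ)
      (E₃ := Bundle.Trivial M ℝ) (b := e.symm)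
      hg (contMDiffOn_coordVector he (EuclideanSpace.single i 1) y hy)
      (contMDiffOn_coordVector he (EuclideanSpace.single j 1) y hy)
    simp only [Bundle.contMDiffWithinAt_totalSpace] at this
    exact this.2
  · refine Matrix.PosDef.of_dotProduct_mulVec_pos (by
      rw [Matrix.IsHermitian, Matrix.conjTranspose_eq_transpose_of_trivial]
      exact Matrix.IsSymm.ext fun i j => g.symm _ _ _) fun v hv => ?_
    set D := mfderiv 𝓘(ℝ, Model n) 𝓘(ℝ, Model n) e.symm y with hD
    set w : Model n := WithLp.toLp 2 v with hw
    have hw0 : w ≠ 0 := fun h => hv (by simpa [hw] using h)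
    have hsum : w = ∑ i, v i • (EuclideanSpace.single i (1 : ℝ) : Model n) := by
      ext j
      simp [hw, Pi.single_apply]
    have hDw : D w = ∑ i, v i • D (EuclideanSpace.single i (1 : ℝ) : Model n) := by
      rw [hsum]
      erw [map_sum]
      exact Finset.sum_congr rfl fun i _ => map_smul D _ _
    have hDw0 : D w ≠ 0 := fun h => hw0 (coordVector_injective he hy (by
      rw [← hD, h]; exact (map_zero D).symm))
    have hp := g.pos _ _ hDw0
    rw [hDw] at hp
    simp only [map_sum, map_smul, sum_apply, smul_apply,
      smul_eq_mul] at hp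
    simp only [dotProduct, Matrix.mulVec, star_trivial, Finset.mul_sum, Metric.inChart,
      Matrix.of_apply]
    refine hp.trans_eq ?_
    rw [Finset.sum_comm]
    refine Finset.sum_congr rfl fun i _ => ?_
    rw [Finset.mul_sum]
    refine Finset.sum_congr rfl fun j _ => ?_
    rw [← hD]
    ring

end Charts

/-! ### Linear algebra of the symbol at a point. -/

section Algebra

open Matrix

variable {n : ℕ} {g G η : Matrix (Fin n) (Fin n) ℝ} (ξ : Fin n → ℝ)

theorem isSymm_of_posDef (hg : g.PosDef) : g.IsSymm := by
  have := hg.1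
  rwa [IsHermitian, conjTranspose_eq_transpose_of_trivial] at this

theorem quadForm_eq (G : Matrix (Fin n) (Fin n) ℝ) : quadForm G ξ = ξ ⬝ᵥ G *ᵥ ξ := by
  simp only [quadForm, dotProduct, mulVec, Finset.mul_sum]
  exact Finset.sum_congr rfl fun _ _ => Finset.sum_congr rfl fun _ _ => by ring

theorem christoffelSymbol_eq (hη : η.IsSymm) (k i j : Fin n) : christoffelSymbol G ξ η k i j =
    (1 / 2) * (ξ i * (G * η) k j + ξ j * (G * η) k i - (G *ᵥ ξ) k * η i j) := by
  simp only [christoffelSymbol, Matrix.mul_apply, mulVec, dotProduct, Finset.mul_sum,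
    Finset.sum_mul, ← Finset.sum_add_distrib, ← Finset.sum_sub_distrib]
  refine Finset.sum_congr rfl fun l _ => ?_
  rw [hη.apply l j, hη.apply l i]
  ring

theorem sum_mul_mulVec (hG : G.IsSymm) (z z' : Fin n → ℝ) :
    z ⬝ᵥ G *ᵥ z' = z' ⬝ᵥ G *ᵥ z := by
  rw [dotProduct_mulVec, ← mulVec_transpose, hG, dotProduct_comm]

theorem dotProduct_mul_col (hG : G.IsSymm) (hη : η.IsSymm) (j : Fin n) :
    ∑ k, ξ k * (G * η) k j = (η *ᵥ (G *ᵥ ξ)) j := by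
  rw [mulVec_mulVec, mulVec, dotProduct]
  refine Finset.sum_congr rfl fun k _ => ?_
  rw [mul_comm, ← transpose_apply (G * η), transpose_mul, hG, hη]

theorem sum_christoffelSymbol (hη : η.IsSymm) (i : Fin n) :
    ∑ k, christoffelSymbol G ξ η k i k = (1 / 2) * (ξ i * (G * η).trace +
      (∑ k, ξ k * (G * η) k i - (η *ᵥ (G *ᵥ ξ)) i)) := by
  simp only [christoffelSymbol_eq ξ hη, ← Finset.mul_sum, Finset.sum_sub_distrib,
    Finset.sum_add_distrib]
  rw [mulVec, dotProduct]
  simp only [mul_comm ((G *ᵥ ξ) _)]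
  rw [Matrix.trace]
  simp only [diag_apply]
  ring

/-- In the contracted Christoffel symbol the two non-trace terms cancel, leaving `½ ξ_i tr(Gη)`; the
divergence term supplies the rest. -/
theorem ricciSymbol_eq (hG : G.IsSymm) (hη : η.IsSymm) (i j : Fin n) : ricciSymbol G ξ η i j =
    (1 / 2) * (ξ i * (η *ᵥ (G *ᵥ ξ)) j + ξ j * (η *ᵥ (G *ᵥ ξ)) i - quadForm G ξ * η i j
      - ξ i * ξ j * (G * η).trace) := by
  rw [ricciSymbol, Finset.sum_sub_distrib, ← Finset.mul_sum, sum_christoffelSymbol ξ hη,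
    dotProduct_mul_col ξ hG hη, sub_self, add_zero]
  have : ∑ k, ξ k * christoffelSymbol G ξ η k i j = (1 / 2) * (ξ i * ∑ k, ξ k * (G * η) k j +
      ξ j * ∑ k, ξ k * (G * η) k i - (∑ k, ξ k * (G *ᵥ ξ) k) * η i j) := by
    simp only [christoffelSymbol_eq ξ hη, Finset.mul_sum, Finset.sum_mul,
      ← Finset.sum_add_distrib, ← Finset.sum_sub_distrib]
    exact Finset.sum_congr rfl fun _ _ => by ring
  rw [this, dotProduct_mul_col ξ hG hη, dotProduct_mul_col ξ hG hη, quadForm_eq]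
  simp only [dotProduct]
  ring

theorem sum_sum_mul_mul (G : Matrix (Fin n) (Fin n) ℝ) (z z' : Fin n → ℝ) :
    ∑ i, ∑ j, G i j * (z i * z' j) = z ⬝ᵥ G *ᵥ z' := by
  simp only [dotProduct, mulVec, Finset.mul_sum]
  exact Finset.sum_congr rfl fun _ _ => Finset.sum_congr rfl fun _ _ => by ring

theorem sum_sum_mul_eq_trace (hη : η.IsSymm) :
    ∑ i, ∑ j, G i j * η i j = (G * η).trace := by
  simp only [Matrix.trace, diag_apply, Matrix.mul_apply]
  exact Finset.sum_congr rfl fun i _ => Finset.sum_congr rfl fun j _ => by rw [hη.apply]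

theorem scalarSymbol_eq (hG : G.IsSymm) (hη : η.IsSymm) : scalarSymbol G ξ η =
    (G *ᵥ ξ) ⬝ᵥ η *ᵥ (G *ᵥ ξ) - quadForm G ξ * (G * η).trace := by
  have h : scalarSymbol G ξ η = (1 / 2) * ((∑ i, ∑ j, G i j * (ξ i * (η *ᵥ (G *ᵥ ξ)) j)) +
      (∑ i, ∑ j, G i j * ((η *ᵥ (G *ᵥ ξ)) i * ξ j)) - quadForm G ξ * ∑ i, ∑ j, G i j * η i j
      - (∑ i, ∑ j, G i j * (ξ i * ξ j)) * (G * η).trace) := by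
    simp only [scalarSymbol, ricciSymbol_eq ξ hG hη, Finset.mul_sum, Finset.sum_mul,
      ← Finset.sum_add_distrib, ← Finset.sum_sub_distrib]
    exact Finset.sum_congr rfl fun _ _ => Finset.sum_congr rfl fun _ _ => by ring
  rw [h, sum_sum_mul_mul, sum_sum_mul_mul, sum_sum_mul_mul, sum_sum_mul_eq_trace hη,
    sum_mul_mulVec hG ξ (η *ᵥ _), ← quadForm_eq, dotProduct_comm (G *ᵥ ξ)]
  ring

theorem vecVSymbol_eq (hG : G.IsSymm) (hη : η.IsSymm) (γ : Fin n) : vecVSymbol G ξ η γ =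
    (G *ᵥ (η *ᵥ (G *ᵥ ξ))) γ - (1 / 2) * ((G *ᵥ ξ) γ * (G * η).trace) := by
  have h : vecVSymbol G ξ η γ = (1 / 2) * ((∑ i, ∑ j, G i j * (ξ i * (G * η) γ j)) +
      (∑ i, ∑ j, G i j * ((G * η) γ i * ξ j)) - (G *ᵥ ξ) γ * ∑ i, ∑ j, G i j * η i j) := by
    simp only [vecVSymbol, christoffelSymbol_eq ξ hη, Finset.mul_sum,
      ← Finset.sum_add_distrib, ← Finset.sum_sub_distrib]
    exact Finset.sum_congr rfl fun _ _ => Finset.sum_congr rfl fun _ _ => by ring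
  rw [h, sum_sum_mul_mul, sum_sum_mul_mul, sum_sum_mul_eq_trace hη,
    sum_mul_mulVec hG ξ, mulVec_mulVec (G *ᵥ ξ)]
  simp only [mulVec]
  ring

/-- Both derivatives contract with the lower indices of `A`, so the Christoffel symbol is evaluated
on `v = Gξ` twice. This produces the multiple `η(v,v)` of `v`, where `V` only offers the trace;
hence two parameters `α`, `β`. -/
theorem vecZSymbol_eq (hG : G.IsSymm) (hη : η.IsSymm) (γ : Fin n) : vecZSymbol G ξ η γ =
    quadForm G ξ * (G *ᵥ (η *ᵥ (G *ᵥ ξ))) γ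
      - (1 / 2) * ((G *ᵥ ξ) γ * ((G *ᵥ ξ) ⬝ᵥ η *ᵥ (G *ᵥ ξ))) := by
  have hv : ∀ i, (G *ᵥ ξ) i = ∑ μ, G μ i * ξ μ := fun i => by
    simp only [mulVec, dotProduct]
    exact Finset.sum_congr rfl fun μ _ => by rw [hG.apply]
  have h1 : vecZSymbol G ξ η γ =
      ∑ i, ∑ j, (G *ᵥ ξ) i * (G *ᵥ ξ) j * christoffelSymbol G ξ η γ i j := by
    have e1 : vecZSymbol G ξ η γ = ∑ μ, ∑ i, ∑ j,
        G μ i * ξ μ * ((G *ᵥ ξ) j * christoffelSymbol G ξ η γ i j) := by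
      refine Finset.sum_congr rfl fun μ _ => ?_
      rw [Finset.sum_comm]
      refine Finset.sum_congr rfl fun i _ => ?_
      rw [Finset.sum_comm]
      refine Finset.sum_congr rfl fun j _ => ?_
      rw [hv j]
      simp only [Finset.mul_sum, Finset.sum_mul]
      exact Finset.sum_congr rfl fun _ _ => by ring
    rw [e1, Finset.sum_comm]
    refine Finset.sum_congr rfl fun i _ => ?_
    rw [Finset.sum_comm]
    refine Finset.sum_congr rfl fun j _ => ?_
    rw [hv i]
    simp only [Finset.sum_mul]
    exact Finset.sum_congr rfl fun _ _ => by ring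
  have h2 : vecZSymbol G ξ η γ = (1 / 2) * ((∑ i, ξ i * (G *ᵥ ξ) i) *
      (∑ j, (G * η) γ j * (G *ᵥ ξ) j) + (∑ i, (G * η) γ i * (G *ᵥ ξ) i) *
      (∑ j, ξ j * (G *ᵥ ξ) j) - (G *ᵥ ξ) γ * ∑ i, ∑ j, η i j * ((G *ᵥ ξ) i * (G *ᵥ ξ) j)) := by
    rw [h1]
    simp only [christoffelSymbol_eq ξ hη, Finset.mul_sum, Finset.sum_mul,
      ← Finset.sum_add_distrib, ← Finset.sum_sub_distrib]
    rw [Finset.sum_comm]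
    exact Finset.sum_congr rfl fun i _ => Finset.sum_congr rfl fun j _ => by
      rw [hη.apply i j]; ring
  rw [h2, sum_sum_mul_mul, quadForm_eq, mulVec_mulVec (G *ᵥ ξ)]
  simp only [mulVec, dotProduct]
  ring

theorem sum_lower_adjustFieldSymbol (hgG : g * G = 1) (hG : G.IsSymm) (hη : η.IsSymm)
    {k : ℕ} (hk : 1 ≤ k) (c α β : ℝ) (j : Fin n) :
    ∑ l, g j l * adjustFieldSymbol k c α β G ξ η l = (-1) ^ k * c * quadForm G ξ ^ (k - 1) *
      ((α + β) * quadForm G ξ * (η *ᵥ (G *ᵥ ξ)) j -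
        (1 / 2) * ξ j * (α * quadForm G ξ * (G * η).trace +
          β * ((G *ᵥ ξ) ⬝ᵥ η *ᵥ (G *ᵥ ξ)))) := by
  have hlow : ∀ z : Fin n → ℝ, ∑ l, g j l * (G *ᵥ z) l = z j := fun z => by
    have : g *ᵥ (G *ᵥ z) = z := by rw [mulVec_mulVec, hgG, one_mulVec]
    exact congrFun this j
  obtain ⟨k, rfl⟩ : ∃ m, k = m + 1 := ⟨k - 1, by omega⟩
  have h : ∑ l, g j l * adjustFieldSymbol (k + 1) c α β G ξ η l =
      (-1) ^ (k + 1) * c * quadForm G ξ ^ k *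
      ((α + β) * quadForm G ξ * (∑ l, g j l * (G *ᵥ (η *ᵥ (G *ᵥ ξ))) l) -
        (1 / 2) * (∑ l, g j l * (G *ᵥ ξ) l) * (α * quadForm G ξ * (G * η).trace +
          β * ((G *ᵥ ξ) ⬝ᵥ η *ᵥ (G *ᵥ ξ)))) := by
    simp only [adjustFieldSymbol, vecVSymbol_eq ξ hG hη, vecZSymbol_eq ξ hG hη,
      Finset.mul_sum, Finset.sum_mul, ← Finset.sum_sub_distrib, Nat.add_sub_cancel]
    exact Finset.sum_congr rfl fun _ _ => by ring
  rw [h, hlow, hlow]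
  rfl

/-- The gauge term only changes multiples of `ξ_i (ηv)_j + ξ_j (ηv)_i` and of `ξ_i ξ_j`. Its sign
`(-1)^k` is opposite to that of the curvature term, which is why `α + β` is subtracted from the `½`
of Ricci. -/
theorem adjustedOpSymbol_eq (hg : g.IsSymm) (hgG : g * G = 1) (hG : G.IsSymm) (hη : η.IsSymm)
    {k : ℕ} (hk : 1 ≤ k) (a b c α β : ℝ) (i j : Fin n) :
    adjustedOpSymbol k a b c α β g G ξ η i j =
      (-1) ^ (k + 1) * c * quadForm G ξ ^ (k - 1) *
      (quadForm G ξ * (1 / 2 - (α + β)) * (ξ i * (η *ᵥ (G *ᵥ ξ)) j + ξ j * (η *ᵥ (G *ᵥ ξ)) i)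
        - (1 / 2) * quadForm G ξ ^ 2 * η i j
        + a * quadForm G ξ * scalarSymbol G ξ η * g i j
        + ((α - 1 / 2) * quadForm G ξ * (G * η).trace + β * ((G *ᵥ ξ) ⬝ᵥ η *ᵥ (G *ᵥ ξ))
          - b * scalarSymbol G ξ η) * (ξ i * ξ j)) := by
  have h : ∑ l, (g l j * (ξ i * adjustFieldSymbol k c α β G ξ η l) +
      g i l * (ξ j * adjustFieldSymbol k c α β G ξ η l)) =
      ξ i * ∑ l, g j l * adjustFieldSymbol k c α β G ξ η l +
      ξ j * ∑ l, g i l * adjustFieldSymbol k c α β G ξ η l := by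
    simp only [Finset.mul_sum, ← Finset.sum_add_distrib]
    refine Finset.sum_congr rfl fun l _ => ?_
    rw [hg.apply j l]
    ring
  rw [adjustedOpSymbol, h, sum_lower_adjustFieldSymbol ξ hgG hG hη hk,
    sum_lower_adjustFieldSymbol ξ hgG hG hη hk, ricciSymbol_eq ξ hG hη]
  obtain ⟨k, rfl⟩ : ∃ m, k = m + 1 := ⟨k - 1, by omega⟩
  simp only [Nat.add_sub_cancel]
  ring

theorem tensorInner_eq (hG : g⁻¹.IsSymm) (θ : Matrix (Fin n) (Fin n) ℝ) :
    tensorInner g θ η = ∑ i, ∑ j, θ i j * (g⁻¹ * η * g⁻¹) i j := by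
  simp only [tensorInner, Matrix.mul_apply, Finset.sum_mul, Finset.mul_sum]
  refine Finset.sum_congr rfl fun i _ => Finset.sum_congr rfl fun j _ => ?_
  rw [Finset.sum_comm]
  refine Finset.sum_congr rfl fun l _ => Finset.sum_congr rfl fun k _ => ?_
  rw [hG.apply l j]
  ring

theorem sum_sum_mul_sandwich (z z' : Fin n → ℝ) (hG : G.IsSymm) :
    ∑ i, ∑ j, z i * z' j * (G * η * G) i j = (G *ᵥ z) ⬝ᵥ η *ᵥ (G *ᵥ z') := by
  have : z ⬝ᵥ (G * η * G) *ᵥ z' = (G *ᵥ z) ⬝ᵥ η *ᵥ (G *ᵥ z') := by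
    rw [← mulVec_mulVec, ← mulVec_mulVec, dotProduct_mulVec z G, ← mulVec_transpose, hG]
  rw [← this, ← sum_sum_mul_mul]
  exact Finset.sum_congr rfl fun _ _ => Finset.sum_congr rfl fun _ _ => by ring

theorem sum_sum_metric_sandwich (hgs : g.IsSymm) (hgG : g * G = 1) :
    ∑ i, ∑ j, g i j * (G * η * G) i j = (G * η).trace := by
  have h : ∑ i, ∑ j, g i j * (G * η * G) i j = (g * (G * η * G)).trace := by
    rw [Finset.sum_comm]
    simp only [Matrix.trace, diag_apply, Matrix.mul_apply (M := g)]
    exact Finset.sum_congr rfl fun i _ => Finset.sum_congr rfl fun j _ => by rw [hgs.apply]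
  rw [h, ← mul_assoc, ← mul_assoc, hgG, one_mul, trace_mul_comm]

/-- The quadratic form of the symbol of the linearization of `-L`. -/
theorem tensorInner_adjustedOpSymbol (hg : g.PosDef) (hη : η.IsSymm) {k : ℕ} (hk : 1 ≤ k)
    (a b c α β : ℝ) {σ : Matrix (Fin n) (Fin n) ℝ}
    (hσ : ∀ i j, σ i j = (-1) ^ (k + 1) * -adjustedOpSymbol k a b c α β g g⁻¹ ξ η i j) :
    tensorInner g σ η = c * quadForm g⁻¹ ξ ^ (k - 1) *
      ((1 / 2) * quadForm g⁻¹ ξ ^ 2 * tensorInner g η η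
        - a * quadForm g⁻¹ ξ * scalarSymbol g⁻¹ ξ η * (g⁻¹ * η).trace
        - quadForm g⁻¹ ξ * (1 - 2 * (α + β)) *
          ((η *ᵥ (g⁻¹ *ᵥ ξ)) ⬝ᵥ g⁻¹ *ᵥ (η *ᵥ (g⁻¹ *ᵥ ξ)))
        - ((α - 1 / 2) * quadForm g⁻¹ ξ * (g⁻¹ * η).trace
          + β * ((g⁻¹ *ᵥ ξ) ⬝ᵥ η *ᵥ (g⁻¹ *ᵥ ξ)) - b * scalarSymbol g⁻¹ ξ η)
          * ((g⁻¹ *ᵥ ξ) ⬝ᵥ η *ᵥ (g⁻¹ *ᵥ ξ))) := by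
  have hgs : g.IsSymm := isSymm_of_posDef hg
  have hG : g⁻¹.IsSymm := hgs.inv
  have hgG : g * g⁻¹ = 1 := mul_nonsing_inv _ (isUnit_iff_ne_zero.2 hg.det_pos.ne')
  have h : tensorInner g σ η = -c * quadForm g⁻¹ ξ ^ (k - 1) *
      (quadForm g⁻¹ ξ * (1 / 2 - (α + β)) *
        ((∑ i, ∑ j, ξ i * (η *ᵥ (g⁻¹ *ᵥ ξ)) j * (g⁻¹ * η * g⁻¹) i j) +
          ∑ i, ∑ j, (η *ᵥ (g⁻¹ *ᵥ ξ)) i * ξ j * (g⁻¹ * η * g⁻¹) i j)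
        - (1 / 2) * quadForm g⁻¹ ξ ^ 2 * (∑ i, ∑ j, η i j * (g⁻¹ * η * g⁻¹) i j)
        + a * quadForm g⁻¹ ξ * scalarSymbol g⁻¹ ξ η * (∑ i, ∑ j, g i j * (g⁻¹ * η * g⁻¹) i j)
        + ((α - 1 / 2) * quadForm g⁻¹ ξ * (g⁻¹ * η).trace
          + β * ((g⁻¹ *ᵥ ξ) ⬝ᵥ η *ᵥ (g⁻¹ *ᵥ ξ)) - b * scalarSymbol g⁻¹ ξ η) *
          ∑ i, ∑ j, ξ i * ξ j * (g⁻¹ * η * g⁻¹) i j) := by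
    rw [tensorInner_eq hG]
    simp only [Finset.mul_sum, ← Finset.sum_add_distrib, ← Finset.sum_sub_distrib]
    refine Finset.sum_congr rfl fun i _ => Finset.sum_congr rfl fun j _ => ?_
    rw [hσ, adjustedOpSymbol_eq ξ hgs hgG hG hη hk]
    -- The sign in the definition of the principal symbol cancels the sign of the flow tensor.
    have hs : ((-1 : ℝ) ^ (k + 1)) * (-1) ^ (k + 1) = 1 := by
      rw [← mul_pow]; norm_num
    linear_combination (-c * quadForm g⁻¹ ξ ^ (k - 1) *
      (quadForm g⁻¹ ξ * (1 / 2 - (α + β)) *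
        (ξ i * (η *ᵥ (g⁻¹ *ᵥ ξ)) j + ξ j * (η *ᵥ (g⁻¹ *ᵥ ξ)) i)
        - (1 / 2) * quadForm g⁻¹ ξ ^ 2 * η i j
        + a * quadForm g⁻¹ ξ * scalarSymbol g⁻¹ ξ η * g i j
        + ((α - 1 / 2) * quadForm g⁻¹ ξ * (g⁻¹ * η).trace
          + β * ((g⁻¹ *ᵥ ξ) ⬝ᵥ η *ᵥ (g⁻¹ *ᵥ ξ)) - b * scalarSymbol g⁻¹ ξ η) *
          (ξ i * ξ j)) * (g⁻¹ * η * g⁻¹) i j) * hs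
  rw [h, sum_sum_mul_sandwich _ _ hG, sum_sum_mul_sandwich _ _ hG, sum_sum_mul_sandwich _ _ hG,
    sum_sum_metric_sandwich hgs hgG, ← tensorInner_eq hG,
    sum_mul_mulVec hη (g⁻¹ *ᵥ ξ) (g⁻¹ *ᵥ _),
    dotProduct_comm (g⁻¹ *ᵥ (η *ᵥ (g⁻¹ *ᵥ ξ)))]
  ring

/-- The Gram matrix of this inner product is the Kronecker product `g⁻¹ ⊗ g⁻¹`. -/
theorem tensorInner_self_nonneg (hg : g.PosDef) (θ : Matrix (Fin n) (Fin n) ℝ) :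
    0 ≤ tensorInner g θ θ := by
  have h := (hg.inv.posSemidef.kronecker hg.inv.posSemidef).dotProduct_mulVec_nonneg
    (fun p : Fin n × Fin n => θ p.1 p.2)
  refine h.trans_eq ?_
  simp only [dotProduct, mulVec, star_trivial, Fintype.sum_prod_type, kroneckerMap_apply,
    tensorInner, Finset.mul_sum]
  exact Finset.sum_congr rfl fun i _ => Finset.sum_congr rfl fun j _ =>
    Finset.sum_congr rfl fun k _ => Finset.sum_congr rfl fun l _ => by ring

/-- The symmetric tensor `|ξ|² g - ξ ⊗ ξ`. -/
def transverseMetric (g : Matrix (Fin n) (Fin n) ℝ) (ξ : Fin n → ℝ) :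
    Matrix (Fin n) (Fin n) ℝ :=
  quadForm g⁻¹ ξ • g - vecMulVec ξ ξ

theorem transverseMetric_symm (hg : g.IsSymm) : (transverseMetric g ξ).IsSymm :=
  (hg.smul _).sub (by ext i j; simp [vecMulVec_apply, mul_comm])

theorem transverseMetric_mulVec (hgG : g * g⁻¹ = 1) :
    transverseMetric g ξ *ᵥ (g⁻¹ *ᵥ ξ) = 0 := by
  rw [transverseMetric, sub_mulVec, smul_mulVec, mulVec_mulVec, hgG, one_mulVec,
    vecMulVec_mulVec, ← quadForm_eq]
  simp

theorem trace_inv_mul_transverseMetric (hGg : g⁻¹ * g = 1) :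
    (g⁻¹ * transverseMetric g ξ).trace = ((n : ℝ) - 1) * quadForm g⁻¹ ξ := by
  rw [transverseMetric, mul_sub, mul_smul_comm, hGg, trace_sub, trace_smul, mul_vecMulVec,
    trace_vecMulVec, dotProduct_comm, ← quadForm_eq]
  simp
  ring

/-- Pairing with `g` gives the trace and pairing with `ξ⊗ξ` gives `η(v,v)`. So the scalar curvature
symbol is a pairing with one fixed tensor, which opens it to Cauchy–Schwarz. -/
theorem tensorInner_transverseMetric (hg : g.PosDef) (hη : η.IsSymm) :
    tensorInner g (transverseMetric g ξ) η = -scalarSymbol g⁻¹ ξ η := by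
  have hgs : g.IsSymm := isSymm_of_posDef hg
  have hG : g⁻¹.IsSymm := hgs.inv
  have hgG : g * g⁻¹ = 1 := mul_nonsing_inv _ (isUnit_iff_ne_zero.2 hg.det_pos.ne')
  rw [tensorInner_eq hG, scalarSymbol_eq ξ hG hη, ← sum_sum_mul_sandwich ξ ξ hG,
    ← sum_sum_metric_sandwich hgs hgG]
  simp only [transverseMetric, Matrix.sub_apply, Matrix.smul_apply, smul_eq_mul, vecMulVec_apply,
    Finset.mul_sum, ← Finset.sum_sub_distrib, ← Finset.sum_neg_distrib]
  exact Finset.sum_congr rfl fun i _ => Finset.sum_congr rfl fun j _ => by ring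

theorem scalarSymbol_transverseMetric (hg : g.PosDef) :
    scalarSymbol g⁻¹ ξ (transverseMetric g ξ) = -(((n : ℝ) - 1) * quadForm g⁻¹ ξ ^ 2) := by
  have hgs : g.IsSymm := isSymm_of_posDef hg
  have hu := isUnit_iff_ne_zero.2 hg.det_pos.ne'
  rw [scalarSymbol_eq ξ hgs.inv (transverseMetric_symm ξ hgs),
    transverseMetric_mulVec ξ (mul_nonsing_inv _ hu),
    trace_inv_mul_transverseMetric ξ (nonsing_inv_mul _ hu)]
  simp
  ring

/-- Cauchy–Schwarz for `θ = |ξ|² g - ξ⊗ξ` and `η`, with `|θ|² = (n-1)|ξ|⁴`. -/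
theorem scalarSymbol_sq_le (hg : g.PosDef) (hη : η.IsSymm) :
    scalarSymbol g⁻¹ ξ η ^ 2 ≤ ((n : ℝ) - 1) * quadForm g⁻¹ ξ ^ 2 * tensorInner g η η := by
  have hgs : g.IsSymm := isSymm_of_posDef hg
  have hθ := transverseMetric_symm ξ hgs
  have hsw : tensorInner g η (transverseMetric g ξ) = tensorInner g (transverseMetric g ξ) η := by
    have e : ∀ θ θ' : Matrix (Fin n) (Fin n) ℝ, tensorInner g θ θ' =
        ∑ p : Fin n × Fin n, ∑ q : Fin n × Fin n,
          g⁻¹ p.1 q.1 * g⁻¹ p.2 q.2 * θ p.1 p.2 * θ' q.1 q.2 := fun θ θ' => by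
      simp only [tensorInner, Fintype.sum_prod_type]
    rw [e, e, Finset.sum_comm]
    refine Finset.sum_congr rfl fun p _ => Finset.sum_congr rfl fun q _ => ?_
    rw [hgs.inv.apply p.1, hgs.inv.apply p.2]
    ring
  -- The quadratic polynomial `|xθ + η|²` is nonnegative, so its discriminant is at most zero.
  have key : ∀ x : ℝ, 0 ≤ tensorInner g (transverseMetric g ξ) (transverseMetric g ξ) * (x * x) +
      2 * tensorInner g (transverseMetric g ξ) η * x + tensorInner g η η := by
    intro x
    refine (tensorInner_self_nonneg hg (x • transverseMetric g ξ + η)).trans_eq ?_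
    have : tensorInner g (x • transverseMetric g ξ + η) (x • transverseMetric g ξ + η) =
        tensorInner g (transverseMetric g ξ) (transverseMetric g ξ) * (x * x) +
        tensorInner g (transverseMetric g ξ) η * x + tensorInner g η (transverseMetric g ξ) * x +
        tensorInner g η η := by
      simp only [tensorInner, Finset.sum_mul, ← Finset.sum_add_distrib, Matrix.add_apply,
        Matrix.smul_apply, smul_eq_mul]
      exact Finset.sum_congr rfl fun i _ => Finset.sum_congr rfl fun j _ =>
        Finset.sum_congr rfl fun k _ => Finset.sum_congr rfl fun l _ => by ring
    rw [this, hsw]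
    ring
  have := discrim_le_zero key
  rw [discrim, tensorInner_transverseMetric ξ hg hη, tensorInner_transverseMetric ξ hg hθ,
    scalarSymbol_transverseMetric ξ hg] at this
  linarith

theorem quadForm_nonneg (hg : g.PosDef) : 0 ≤ quadForm g⁻¹ ξ := by
  rw [quadForm_eq]
  simpa using hg.inv.posSemidef.dotProduct_mulVec_nonneg ξ

theorem quadForm_pos (hg : g.PosDef) (hξ : ξ ≠ 0) : 0 < quadForm g⁻¹ ξ := by
  rw [quadForm_eq]
  simpa using hg.inv.dotProduct_mulVec_pos hξ

/-- A lower bound for the symbol, for the special values of `α` and `β`. -/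
theorem le_tensorInner_symbol (hg : g.PosDef) (hη : η.IsSymm) {k : ℕ} (hk : 1 ≤ k)
    {a b c : ℝ} (hc : 0 < c) {σ : Matrix (Fin n) (Fin n) ℝ}
    (hσ : ∀ i j, σ i j =
      (-1) ^ (k + 1) * -adjustedOpSymbol k a b c (1 / 2 + a - b) (b - a) g g⁻¹ ξ η i j) :
    c * (1 / 2 + min a 0 * ((n : ℝ) - 1)) * quadForm g⁻¹ ξ ^ (k + 1) * tensorInner g η η ≤
      tensorInner g σ η := by
  have hgs : g.IsSymm := isSymm_of_posDef hg
  rw [tensorInner_adjustedOpSymbol ξ hg hη hk a b c _ _ hσ]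
  have hq := quadForm_nonneg ξ hg
  have hs := scalarSymbol_sq_le ξ hg hη
  have hS := scalarSymbol_eq ξ hgs.inv hη
  set q := quadForm g⁻¹ ξ
  set s := scalarSymbol g⁻¹ ξ η
  set N := tensorInner g η η
  set t := (g⁻¹ * η).trace
  set e := (g⁻¹ *ᵥ ξ) ⬝ᵥ η *ᵥ (g⁻¹ *ᵥ ξ)
  obtain ⟨k, rfl⟩ : ∃ m, k = m + 1 := ⟨k - 1, by omega⟩
  simp only [Nat.add_sub_cancel]
  have h1 : min a 0 * ((n : ℝ) - 1) * (q ^ 2 * N) ≤ a * s ^ 2 := by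
    have h2 : min a 0 * (((n : ℝ) - 1) * q ^ 2 * N) ≤ min a 0 * s ^ 2 :=
      mul_le_mul_of_nonpos_left hs (min_le_right _ _)
    have h3 : min a 0 * s ^ 2 ≤ a * s ^ 2 :=
      mul_le_mul_of_nonneg_right (min_le_left _ _) (sq_nonneg s)
    linarith
  have h4 : 0 ≤ c * q ^ k := by positivity
  have h5 := mul_le_mul_of_nonneg_left h1 h4
  -- After this substitution all terms other than `½ q² N` combine into `a s²`.
  have he : e = s + q * t := by rw [hS]; ring
  rw [he]
  calc _ = c * q ^ k * (1 / 2 * q ^ 2 * N) +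
        c * q ^ k * (min a 0 * ((n : ℝ) - 1) * (q ^ 2 * N)) := by ring
    _ ≤ c * q ^ k * (1 / 2 * q ^ 2 * N) + c * q ^ k * (a * s ^ 2) := by linarith
    _ = _ := by ring

/-- The value of the symbol on the tensor `|ξ|² g - ξ ⊗ ξ`. -/
theorem tensorInner_symbol_transverseMetric (hg : g.PosDef) {k : ℕ} (hk : 1 ≤ k)
    (a b c α β : ℝ) {σ : Matrix (Fin n) (Fin n) ℝ}
    (hσ : ∀ i j, σ i j = (-1) ^ (k + 1) *
      -adjustedOpSymbol k a b c α β g g⁻¹ ξ (transverseMetric g ξ) i j) :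
    tensorInner g σ (transverseMetric g ξ) =
      c * quadForm g⁻¹ ξ ^ (k + 3) * ((n : ℝ) - 1) * (1 / 2 + a * ((n : ℝ) - 1)) := by
  have hgs : g.IsSymm := isSymm_of_posDef hg
  have hu := isUnit_iff_ne_zero.2 hg.det_pos.ne'
  have hθ := transverseMetric_symm ξ hgs
  rw [tensorInner_adjustedOpSymbol ξ hg hθ hk a b c _ _ hσ,
    transverseMetric_mulVec ξ (mul_nonsing_inv _ hu),
    trace_inv_mul_transverseMetric ξ (nonsing_inv_mul _ hu),
    tensorInner_transverseMetric ξ hg hθ, scalarSymbol_transverseMetric ξ hg]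
  obtain ⟨k, rfl⟩ : ∃ m, k = m + 1 := ⟨k - 1, by omega⟩
  simp only [Nat.add_sub_cancel, dotProduct_zero, mulVec_zero]
  ring

end Algebra

/-! ### The linearization as a differential operator with a well-defined symbol. -/

section Main

variable {n : ℕ} {U : Set (Model n)}

theorem isSmoothSymm_powerFun (y : Model n) (ξ : Fin n → ℝ) (p : ℕ)
    {η : Matrix (Fin n) (Fin n) ℝ} (hη : η.IsSymm) :
    IsSmoothSymm U (fun z => Matrix.of fun i j => η i j * powerFun y ξ p z) :=
  ⟨fun _ _ => (contDiff_const.mul (contDiff_powerFun y ξ p)).contDiffOn, fun z _ =>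
    Matrix.IsSymm.ext fun i j => by simp [hη.apply i j]⟩

/-- The principal symbol is given by the values of the operator on the fields
`(ξ · (z - y))^{2m} / (2m)! η`. -/
theorem IsDiffOpWith.principalSymbol_eq {m : ℕ} {a : OpCoeff n}
    {P : MatrixField n → MatrixField n} (h : IsDiffOpWith U (2 * m) a P) {y : Model n}
    (hy : y ∈ U) (ξ : Fin n → ℝ) {η : Matrix (Fin n) (Fin n) ℝ} (hη : η.IsSymm) :
    principalSymbol m a y ξ η =
      (-1 : ℝ) ^ m • P (fun z => Matrix.of fun i j => η i j * powerFun y ξ (2 * m) z) y := by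
  rw [(h.2 _ (isSmoothSymm_powerFun y ξ (2 * m) hη) y hy).2, principalSymbol]
  congr 1
  -- At `y` the derivatives of the test field of order below `2m` vanish, and those of order `2m`
  -- equal `ξ^β η`.
  have key : ∀ d ∈ Finset.range (2 * m + 1),
      ∀ β ∈ Finset.piAntidiag (Finset.univ : Finset (Fin n)) d,
      a β y (Matrix.of fun i j => multiPd β (fun z => (Matrix.of fun i j =>
        η i j * powerFun y ξ (2 * m) z) i j) y) =
      if d = 2 * m then (∏ i, ξ i ^ β i) • a β y η else 0 := by
    intro d hd β hβ
    have hb : ∑ i, β i = d := (Finset.mem_piAntidiag.1 hβ).1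
    have hd' : d ≤ 2 * m := by simp at hd; omega
    have : (Matrix.of fun i j => multiPd β (fun z => (Matrix.of fun i j =>
        η i j * powerFun y ξ (2 * m) z) i j) y) =
        (if d = 2 * m then ∏ i, ξ i ^ β i else 0) • η := by
      ext i j
      simp only [Matrix.of_apply, Matrix.smul_apply, smul_eq_mul]
      rw [multiPd_powerFun y ξ β _ _ (by omega)]
      beta_reduce
      rw [hb, powerFun_self]
      by_cases h : d = 2 * m
      · simp [h]; ring
      · simp [h, show ¬ 2 * m - d = 0 by omega]
    rw [this, map_smul]
    split_ifs <;> simp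
  rw [Finset.sum_congr rfl fun d hd => Finset.sum_congr rfl (key d hd),
    Finset.sum_eq_single (2 * m)]
  · simp
  · intro d _ hd
    simp [hd]
  · intro h; simp at h

/-- The entrywise symbol calculus is assembled into one matrix-valued operator with an explicit
principal symbol; what remains is that its values are symmetric. -/
theorem exists_isDiffOpWith_negLin (hU : IsOpen U) {g h : MatrixField n}
    (hg : IsLocalMetric U g) (hh : IsLocalMetric U h) {k : ℕ} (hk : 1 ≤ k) (a b c α β : ℝ)
    (T₀ : PolyNaturalTensor n (2 * k + 1)) :
    ∃ A : OpCoeff n, IsDiffOpWith U (2 * (k + 1)) A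
        (linearization (fun g' y => -adjustedOp k a b c α β T₀ g' h y) g) ∧
      ∀ y ∈ U, ∀ ξ η i j, principalSymbol (k + 1) A y ξ η i j =
        (-1) ^ (k + 1) * -adjustedOpSymbol k a b c α β (g y) (g y)⁻¹ ξ η i j := by
  have hL := fun i j => (HasSymbol.adjustedOp hU hg hh hk a b c α β T₀ i j).neg hU
  choose P hP hPL using hL
  choose C hC hPC hτ using hP
  refine ⟨fun κ y => (LinearMap.pi fun i => LinearMap.pi fun j => C i j κ y :
    Matrix (Fin n) (Fin n) ℝ →ₗ[ℝ] Fin n → Fin n → ℝ),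
    ⟨fun κ η i j => hC i j κ η, fun u hu y hy => ⟨?_, ?_⟩⟩, ?_⟩
  · refine Matrix.IsSymm.ext fun i j => ?_
    refine Filter.EventuallyEq.deriv_eq ?_
    -- Symmetry of `L` is available only at metrics, so it is used for small `s`, on a neighbourhood
    -- of `y` where `g + s u` is still one; this suffices for the derivative at `s = 0`.
    filter_upwards [eventually_isLocalMetric hU hg hu hy] with s ⟨V, hV, hyV, hs⟩
    exact congrArg Neg.neg ((adjustedOp_symm hV hs h k a b c α β T₀ hyV).apply i j)
  · ext i j
    rw [Matrix.sum_apply]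
    simp only [Matrix.sum_apply]
    exact (hPL i j u hu y hy).2.trans (hPC i j u hu y hy)
  · intro y hy ξ η i j
    have := hτ i j y hy ξ η
    beta_reduce at this
    unfold principalSymbol
    rw [this, Matrix.smul_apply, Matrix.sum_apply]
    rfl

end Main

end TensorFlow

end
theorem mainTheorem4
    (n : ℕ) (hn : 2 ≤ n)
    (M : Type*) [TopologicalSpace M] [T2Space M] [CompactSpace M] [Nonempty M]
    [ChartedSpace (TensorFlow.Model n) M] [IsManifold 𝓘(ℝ, TensorFlow.Model n) ∞ M]
    (k : ℕ) (hk : 1 ≤ k) (a b c : ℝ) (hc : 0 < c)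
    (T₀ : TensorFlow.PolyNaturalTensor n (2 * k + 1))
    (h : TensorFlow.Metric n M)
    (I : Set ℝ) (hI : I.Nonempty) (g : ℝ → TensorFlow.Metric n M) :
    (∀ α β : ℝ, TensorFlow.IsLinearDiffOp I (2 * (k + 1))
      (fun t => TensorFlow.negLinOp k a b c α β T₀ (g t) h)) ∧
    (-(1 / (2 * ((n : ℝ) - 1))) < a →
      TensorFlow.StronglyElliptic I (k + 1) g
        (fun t => TensorFlow.negLinOp k a b c (1 / 2 + a - b) (b - a) T₀ (g t) h)) ∧
    (a ≤ -(1 / (2 * ((n : ℝ) - 1))) →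
      ∀ α β : ℝ, ¬ TensorFlow.StronglyElliptic I (k + 1) g
        (fun t => TensorFlow.negLinOp k a b c α β T₀ (g t) h)) := by
  have hn1 : (1 : ℝ) ≤ (n : ℝ) - 1 := by
    have : (2 : ℝ) ≤ n := by exact_mod_cast hn
    linarith
  have hn0 : (0 : ℝ) < (n : ℝ) - 1 := by linarith
  have hop := fun (α β : ℝ) (t : ℝ) (e : OpenPartialHomeomorph M (TensorFlow.Model n))
    (he : e ∈ TensorFlow.charts n M) =>
    TensorFlow.exists_isDiffOpWith_negLin e.open_target
      (TensorFlow.isLocalMetric_inChart (g t) he) (TensorFlow.isLocalMetric_inChart h he) hk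
      a b c α β T₀
  refine ⟨fun α β t _ e he => ?_, fun ha => ?_, fun ha α β => ?_⟩
  · obtain ⟨A, hA, -⟩ := hop α β t e he
    exact ⟨A, hA⟩
  · refine ⟨c * (1 / 2 + min a 0 * ((n : ℝ) - 1)), mul_pos hc ?_, fun t _ e he => ?_⟩
    · rcases min_choice a 0 with hm | hm
      · rw [hm]
        have := mul_lt_mul_of_pos_right ha hn0
        have h2 : -(1 / (2 * ((n : ℝ) - 1))) * ((n : ℝ) - 1) = -(1 / 2) := by
          field_simp
        linarith
      · rw [hm]; norm_num
    · obtain ⟨A, hA, hs⟩ := hop (1 / 2 + a - b) (b - a) t e he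
      refine ⟨A, hA, fun y hy ξ η hη => ?_⟩
      exact TensorFlow.le_tensorInner_symbol ξ
        ((TensorFlow.isLocalMetric_inChart (g t) he).2 y hy) hη hk hc (hs y hy ξ η)
  · rintro ⟨Λ, hΛ, hell⟩
    obtain ⟨t, ht⟩ := hI
    obtain ⟨x⟩ := ‹Nonempty M›
    set e := chartAt (TensorFlow.Model n) x
    have he : e ∈ TensorFlow.charts n M := IsManifold.chart_mem_maximalAtlas x
    have hy : e x ∈ e.target := e.map_source (mem_chart_source _ x)
    have hg := (TensorFlow.isLocalMetric_inChart (g t) he).2 (e x) hy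
    obtain ⟨A, hA, hbound⟩ := hell t ht e he
    obtain ⟨A', hA', hs⟩ := hop α β t e he
    -- Any nonzero covector would do.
    set ξ : Fin n → ℝ := fun _ => 1
    have hξ : ξ ≠ 0 := fun h0 => one_ne_zero (congrFun h0 ⟨0, by omega⟩)
    set G := (g t).inChart e (e x)
    have hη := TensorFlow.transverseMetric_symm ξ (TensorFlow.isSymm_of_posDef hg)
    have hb : Λ * TensorFlow.covectorNormSq G ξ ^ (k + 1) * TensorFlow.tensorInner G
        (TensorFlow.transverseMetric G ξ) (TensorFlow.transverseMetric G ξ) ≤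
        TensorFlow.tensorInner G (TensorFlow.principalSymbol (k + 1) A (e x) ξ
          (TensorFlow.transverseMetric G ξ)) (TensorFlow.transverseMetric G ξ) :=
      hbound (e x) hy ξ _ hη
    -- Ellipticity supplies unknown coefficients `A`; they have the same symbol on symmetric tensors
    -- as the computed ones `A'`.
    rw [(hA.principalSymbol_eq hy ξ hη).trans (hA'.principalSymbol_eq hy ξ hη).symm,
      TensorFlow.tensorInner_symbol_transverseMetric ξ hg hk a b c α β (hs (e x) hy ξ _),
      TensorFlow.tensorInner_transverseMetric ξ hg hη,
      TensorFlow.scalarSymbol_transverseMetric ξ hg] at hb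
    have hq : 0 < TensorFlow.covectorNormSq G ξ := TensorFlow.quadForm_pos ξ hg hξ
    change _ ≤ c * TensorFlow.covectorNormSq G ξ ^ (k + 3) * _ * _ at hb
    change _ * -(-(_ * TensorFlow.covectorNormSq G ξ ^ 2)) ≤ _ at hb
    -- The left side of the ellipticity bound is positive, as `|θ|² = (n-1)|ξ|⁴ > 0` for `n ≥ 2`,
    -- while the right side has the sign of `½ + a(n-1) ≤ 0`.
    have h1 : 0 < Λ * TensorFlow.covectorNormSq G ξ ^ (k + 1) *
        -(-(((n : ℝ) - 1) * TensorFlow.covectorNormSq G ξ ^ 2)) := by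
      rw [neg_neg]; positivity
    have h2 : 1 / 2 + a * ((n : ℝ) - 1) ≤ 0 := by
      have := mul_le_mul_of_nonneg_right ha hn0.le
      have h2 : -(1 / (2 * ((n : ℝ) - 1))) * ((n : ℝ) - 1) = -(1 / 2) := by
        field_simp
      linarith
    have h3 : c * TensorFlow.covectorNormSq G ξ ^ (k + 3) * ((n : ℝ) - 1) *
        (1 / 2 + a * ((n : ℝ) - 1)) ≤ 0 :=
      mul_nonpos_of_nonneg_of_nonpos (by positivity) h2
    linarith
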